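/- Let $\nu$ be a Borel probability measure on $\mathbb{R}$ with $\int y^2\,d\nu(y)<\infty$, let $\beta>0$, and let $\mu=\nu^{\otimes\mathbb{N}}$. For $\mathbf h=(h_i)_{i\ge1}\in\mathbb{R}^{\mathbb{N}}$ and $n\ge 1$ let $P_{n,\beta}^{\mathbf h}$ be the probability measure on $\{-1,+1\}^n$ with $$P_{n,\beta}^{\mathbf h}(\sigma)=\frac1{Z_{n,\beta}^{\mathbf h}}\exp\Big(\frac{\beta}{2n}S_n(\sigma)^2+\beta\sum_{i=1}^n h_i\sigma_i\Big),\qquad S_n(\sigma)=\sum_{i=1}^n\sigma_i,$$ where $Z_{n,\beta}^{\mathbf h}$ is the normalizing constant. Put $$G(x)=\frac{\beta}{2}x^2-\int_{\mathbb{R}}\ln\cosh[\beta(x+y)]\,d\nu(y).$$ Let $m\in\mathbb{R}$ be a (local or global) minimum of $G$ of type $k\in\{1,2,\dots\}$ and strength $\lambda>0$, i.e. $G(x)=G(m)+\frac{\lambda}{(2k)!}(x-m)^{2k}+\mathcal{O}((x-m)^{2k+1})$ as $x\to m$. Let $h(m)=G(m)-\inf_{w\in\mathbb{R}}G(w)$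 be its height and $b(m)=\inf\{|y-m| : G(y)<G(m)\}\in(0,\infty]$ its broadness (with $\inf\emptyset=\infty$), and assume $$\beta>\frac{2h(m)}{b(m)^2}$$ (the right-hand side being $0$ if $b(m)=\infty$). Then there exists $A=A(m)>0$ such that for $\mu$-almost every $\mathbf h$ the following holds: for all $0<a<A$ and all $1-\frac{1}{2(2k-1)}<\alpha<1$, the sequence of measures $$P_n:=P_{n,\beta}^{\mathbf h}\Big(\frac{S_n-nm}{n^{\alpha}}\in\bullet\ \Big|\ \frac{S_n}{n}\in[m-a,m+a]\Big)$$ (defined for all sufficiently large $n$) satisfies a moderate deviations principle with speed $a_n=n^{1-2k(1-\alpha)}$ and rate function $$I(x)=\begin{cases}\dfrac{x^2}{2\sigma^2},\ \ \sigma^2=\lambda^{-1}-\beta^{-1}, & k=1,\\[2mm] \dfrac{\lambda x^{2k}}{(2k)!}, & k\ge2;\end{cases}$$ that is, $I$ is lower semicontinuous with compact level sets $\{I\le c\}$, $c\in\mathbb{R}$, and for every Borel set $C\subseteq\mathbb{R}$ $$-\inf_{x\in C^\circ}I(x)\le\liminf_{n\to\infty}\frac1{a_n}\ln P_n(C)\le\limsup_{n\to\infty}\frac1{a_n}\ln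 P_n(C)\le-\inf_{x\in\overline C}I(x).$$ -/

import Mathlib

open MeasureTheory ProbabilityTheory Filter Topology Asymptotics
open scoped ENNReal

namespace RFCW

noncomputable section

/-- Spin configurations: elements of `{-1, +1}ⁿ`. -/
abbrev Config (n : ℕ) : Type := Fin n → ({-1, 1} : Finset ℤ)

/-- Total magnetization `S_n(σ) = ∑ σ_i`. -/
def magnetization {n : ℕ} (σ : Config n) : ℝ := ∑ i, ((σ i : ℤ) : ℝ)

/-- Boltzmann weight `exp (β / (2 n) (∑ σ_i)² + β ∑ h_i σ_i)`; the field is indexed from `0`. -/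
def weight (β : ℝ) (h : ℕ → ℝ) {n : ℕ} (σ : Config n) : ℝ :=
  Real.exp (β / (2 * n) * magnetization σ ^ 2 + β * ∑ i : Fin n, h i * ((σ i : ℤ) : ℝ))

/-- Partition function. -/
def partitionFunction (β : ℝ) (h : ℕ → ℝ) (n : ℕ) : ℝ := ∑ σ : Config n, weight β h σ

/-- Gibbs measure `P_{n,β}^h` on `{-1, +1}ⁿ`, for a realization `h` of the external field. -/
def gibbs (β : ℝ) (h : ℕ → ℝ) (n : ℕ) : Measure (Config n) :=
  ∑ σ : Config n, ENNReal.ofReal (weight β h σ / partitionFunction β h n) • Measure.dirac σ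

/-- Law of the field: the `ℕ`-fold product of the marginal distribution `ν`. -/
def fieldLaw (ν : Measure ℝ) : Measure (ℕ → ℝ) := Measure.infinitePi fun _ : ℕ => ν

/-- `G(x) = (β / 2) x² - ∫ ln cosh (β (x + y)) dν(y)`. -/
def G (β : ℝ) (ν : Measure ℝ) (x : ℝ) : ℝ :=
  β / 2 * x ^ 2 - ∫ y, Real.log (Real.cosh (β * (x + y))) ∂ν

/-- `m` is a (local or global) minimum of `g` of type `k` and strength `lam`. -/
structure IsMinimumOfType (g : ℝ → ℝ) (m : ℝ) (k : ℕ) (lam : ℝ) : Prop where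
  isLocalMin : IsLocalMin g m
  one_le : 1 ≤ k
  strength_pos : 0 < lam
  expansion : (fun x => g x - (g m + lam / (2 * k).factorial * (x - m) ^ (2 * k)))
    =O[𝓝 m] fun x => (x - m) ^ (2 * k + 1)

/-- Height of `m`: `g(m) - inf g`. -/
def height (g : ℝ → ℝ) (m : ℝ) : ℝ := g m - ⨅ w, g w

/-- Broadness of `m`: the infimum of `|y - m|` over all `y` with `g(y) < g(m)`; it is `∞` if there
is no such `y`, that is, if `m` is a global minimum. -/
def broadness (g : ℝ → ℝ) (m : ℝ) : ℝ≥0∞ := ⨅ (y : ℝ) (_ : g y < g m), ENNReal.ofReal |y - m|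

/-- Large (or moderate) deviations principle on `ℝ` with speed `a` and good rate function `I`.
The logarithm takes the value `-∞` at `0`, and the infimum over the empty set is `+∞`. -/
structure SatisfiesLDP (P : ℕ → Measure ℝ) (a : ℕ → ℝ) (I : ℝ → EReal) : Prop where
  lowerSemicontinuous : LowerSemicontinuous I
  isCompact_level : ∀ c : ℝ, IsCompact {x | I x ≤ (c : EReal)}
  lower_bound : ∀ C : Set ℝ, MeasurableSet C →
    -(⨅ x ∈ interior C, I x) ≤ liminf (fun n => ENNReal.log (P n C) / (a n : EReal)) atTop
  upper_bound : ∀ C : Set ℝ, MeasurableSet C →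
    limsup (fun n => ENNReal.log (P n C) / (a n : EReal)) atTop ≤ -(⨅ x ∈ closure C, I x)

/-- Law of `(S_n - n m) / n^α` under `P_{n,β}^h` conditioned on `S_n / n ∈ [m - r, m + r]`. -/
def conditionedLaw (β : ℝ) (h : ℕ → ℝ) (m r α : ℝ) (n : ℕ) : Measure ℝ :=
  (cond (gibbs β h n) {σ | magnetization σ / n ∈ Set.Icc (m - r) (m + r)}).map
    fun σ => (magnetization σ - n * m) / (n : ℝ) ^ α

/-- `x² / (2 σ²)` with `σ² = λ⁻¹ - β⁻¹` if `k = 1`, and `λ x^{2k} / (2k)!` otherwise. -/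
def rateFunction (k : ℕ) (lam β x : ℝ) : ℝ :=
  if k = 1 then x ^ 2 / (2 * (lam⁻¹ - β⁻¹)) else lam * x ^ (2 * k) / (2 * k).factorial

end

end RFCW

/-!
For every `x`, completing the square writes the Boltzmann weight of `σ` as
`2 ^ n * exp (-n * Gₙ x + n * β / 2 * (Sₙ / n - x) ^ 2)` times the weight of `σ` under a product
measure, the tilt at `x`, where `Gₙ` is `G` with `ν` replaced by the empirical measure of the field.
The total weight of a set is thus bounded above by choosing, for each of the at most `2 n + 1`
values of `Sₙ`, the best `x`; it is bounded below because the tilted measure concentrates: moving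
`x` slightly to either side shows that both tails are exponentially small. By Hoeffding's inequality
on a grid of spacing `1 / n` and the Borel–Cantelli lemma, almost surely the increments of `n Gₙ`
from `m` differ from those of `n G` by `O(|u| √(n ln n) + 1)`, which is negligible for the `α` in
question, so `Gₙ` may be replaced by the Taylor expansion of `G` at `m`. To reach the value `z` of
`(Sₙ - n m) / n ^ α` the best tilt is at `m + n ^ (α - 1) c z`, with `c = β / (β - λ)` for `k = 1`
(the second difference of `G` at `m` shows `λ < β`) and `c = 1` for `k ≥ 2`.
-/

namespace RFCW

noncomputable section

theorem lipschitzWith_log_cosh : LipschitzWith 1 fun x : ℝ => Real.log (Real.cosh x) := by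
  have hderiv (x : ℝ) : HasDerivAt (fun x => Real.log (Real.cosh x)) (Real.tanh x) x := by
    rw [Real.tanh_eq_sinh_div_cosh]
    exact (Real.hasDerivAt_cosh x).log (Real.cosh_pos x).ne'
  refine lipschitzWith_of_nnnorm_deriv_le (fun x => (hderiv x).differentiableAt) fun x => ?_
  rw [(hderiv x).deriv]
  exact (Real.abs_tanh_lt_one x).le

theorem integrable_log_cosh {Ω : Type*} {mΩ : MeasurableSpace Ω} {μ : Measure Ω} {X : Ω → ℝ}
    (hX : Integrable X μ) : Integrable (fun ω => Real.log (Real.cosh (X ω))) μ :=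
  memLp_one_iff_integrable.mp <|
    lipschitzWith_log_cosh.comp_memLp (by simp) (memLp_one_iff_integrable.mpr hX)

theorem log_cosh_add_add_log_cosh_sub (b t : ℝ) :
    Real.log (Real.cosh (b + t)) + Real.log (Real.cosh (b - t)) =
      2 * Real.log (Real.cosh b) + Real.log (1 + Real.sinh t ^ 2 / Real.cosh b ^ 2) := by
  have hmul : Real.cosh (b + t) * Real.cosh (b - t) =
      Real.cosh b ^ 2 * (1 + Real.sinh t ^ 2 / Real.cosh b ^ 2) := by
    rw [Real.cosh_add, Real.cosh_sub]
    field_simp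
    linear_combination Real.cosh b ^ 2 * Real.cosh_sq t + Real.sinh t ^ 2 * Real.cosh_sq b
  rw [← Real.log_mul (Real.cosh_pos _).ne' (Real.cosh_pos _).ne', hmul,
    Real.log_mul (by positivity) (by positivity), Real.log_pow, Nat.cast_ofNat]

theorem half_le_log_one_add {s : ℝ} (hs : 0 ≤ s) (hs' : s ≤ 2) : s / 2 ≤ Real.log (1 + s) := by
  refine le_trans ?_ (Real.le_log_one_add_of_nonneg hs)
  rw [div_le_div_iff₀ two_pos (by positivity)]
  nlinarith

theorem le_log_cosh_secondDifference {t : ℝ} (ht : Real.sinh t ^ 2 ≤ 2) (b : ℝ) :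
    t ^ 2 / 2 * (Real.cosh b ^ 2)⁻¹ ≤
      Real.log (Real.cosh (b + t)) + Real.log (Real.cosh (b - t)) -
        2 * Real.log (Real.cosh b) := by
  rw [log_cosh_add_add_log_cosh_sub, add_sub_cancel_left]
  have hcosh : 1 ≤ Real.cosh b ^ 2 := one_le_pow₀ (Real.one_le_cosh b)
  have hsinh : t ^ 2 ≤ Real.sinh t ^ 2 := by
    rw [sq_le_sq, Real.abs_sinh]
    exact Real.self_le_sinh_iff.mpr (abs_nonneg t)
  calc t ^ 2 / 2 * (Real.cosh b ^ 2)⁻¹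
      ≤ Real.sinh t ^ 2 / 2 * (Real.cosh b ^ 2)⁻¹ := by gcongr
    _ = Real.sinh t ^ 2 / Real.cosh b ^ 2 / 2 := by ring
    _ ≤ Real.log (1 + Real.sinh t ^ 2 / Real.cosh b ^ 2) :=
        half_le_log_one_add (by positivity) ((div_le_self (sq_nonneg _) hcosh).trans ht)

section FreeEnergy

variable {β : ℝ} {ν : Measure ℝ}

theorem integrable_inv_cosh_sq [IsFiniteMeasure ν] (x : ℝ) :
    Integrable (fun y => (Real.cosh (β * (x + y)) ^ 2)⁻¹) ν := by
  refine Integrable.of_bound (C := 1) (Measurable.aestronglyMeasurable (by fun_prop)) ?_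
  refine Eventually.of_forall fun y => ?_
  rw [Real.norm_of_nonneg (by positivity)]
  exact inv_le_one_of_one_le₀ (one_le_pow₀ (Real.one_le_cosh _))

theorem integral_inv_cosh_sq_pos [IsFiniteMeasure ν] [NeZero ν] (x : ℝ) :
    0 < ∫ y, (Real.cosh (β * (x + y)) ^ 2)⁻¹ ∂ν := by
  have hpos (y : ℝ) : 0 < (Real.cosh (β * (x + y)) ^ 2)⁻¹ := by positivity
  rw [integral_pos_iff_support_of_nonneg (fun y => (hpos y).le) (integrable_inv_cosh_sq x),
    Set.eq_univ_of_forall (s := Function.support _) fun y => (hpos y).ne']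
  exact Measure.measure_univ_pos.mpr (NeZero.ne ν)

theorem integrable_log_cosh_mul_add [IsFiniteMeasure ν] (hν : Integrable (fun y => y) ν)
    (β x : ℝ) : Integrable (fun y => Real.log (Real.cosh (β * (x + y)))) ν :=
  integrable_log_cosh (((integrable_const x).add hν).const_mul β)

theorem G_secondDifference_eq [IsFiniteMeasure ν] (hν : Integrable (fun y => y) ν) (x u : ℝ) :
    G β ν (x + u) + G β ν (x - u) - 2 * G β ν x = β * u ^ 2 -
      ∫ y, (Real.log (Real.cosh (β * (x + y) + β * u)) +
        Real.log (Real.cosh (β * (x + y) - β * u)) -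
          2 * Real.log (Real.cosh (β * (x + y)))) ∂ν := by
  have hint (z : ℝ) := integrable_log_cosh_mul_add hν β z
  have hadd (y : ℝ) : β * (x + y) + β * u = β * (x + u + y) := by ring
  have hsub (y : ℝ) : β * (x + y) - β * u = β * (x - u + y) := by ring
  simp only [hadd, hsub]
  rw [integral_sub ((hint _).fun_add (hint _)) ((hint _).const_mul 2),
    integral_add (hint _) (hint _), integral_const_mul]
  unfold G
  ring

theorem eventually_G_secondDifference_le [IsFiniteMeasure ν] (hν : Integrable (fun y => y) ν)
    (x : ℝ) :
    ∀ᶠ u in 𝓝 0, G β ν (x + u) + G β ν (x - u) - 2 * G β ν x ≤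
      (β - β ^ 2 / 2 * ∫ y, (Real.cosh (β * (x + y)) ^ 2)⁻¹ ∂ν) * u ^ 2 := by
  have hsinh : ∀ᶠ u in 𝓝 (0 : ℝ), Real.sinh (β * u) ^ 2 ≤ 2 := by
    have hcont : Continuous fun u => Real.sinh (β * u) ^ 2 := by fun_prop
    exact (hcont.tendsto' 0 0 (by simp)).eventually (eventually_le_nhds two_pos)
  filter_upwards [hsinh] with u hu
  have hint (z : ℝ) := integrable_log_cosh_mul_add hν β z
  have hmono : ∫ y, (β * u) ^ 2 / 2 * (Real.cosh (β * (x + y)) ^ 2)⁻¹ ∂ν ≤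
      ∫ y, (Real.log (Real.cosh (β * (x + y) + β * u)) +
        Real.log (Real.cosh (β * (x + y) - β * u)) -
          2 * Real.log (Real.cosh (β * (x + y)))) ∂ν := by
    refine integral_mono ((integrable_inv_cosh_sq x).const_mul _) ?_ fun y =>
      le_log_cosh_secondDifference hu _
    have haffine : Integrable (fun y => β * (x + y)) ν :=
      ((integrable_const x).add hν).const_mul β
    exact ((integrable_log_cosh (haffine.add (integrable_const _))).add
      (integrable_log_cosh (haffine.sub (integrable_const _)))).sub ((hint x).const_mul 2)
  rw [integral_const_mul] at hmono
  rw [G_secondDifference_eq hν]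
  linear_combination hmono

end FreeEnergy

section MinimumOfType

variable {g : ℝ → ℝ} {m lam : ℝ} {k : ℕ}

theorem IsMinimumOfType.isLittleO (hm : IsMinimumOfType g m k lam) :
    (fun u => g (m + u) - g m - lam / (2 * k).factorial * u ^ (2 * k)) =o[𝓝 0]
      fun u => u ^ (2 * k) := by
  have hshift : Tendsto (fun u : ℝ => m + u) (𝓝 0) (𝓝 m) :=
    (continuous_const_add m).tendsto' 0 m (add_zero m)
  have hpow : (fun u : ℝ => u ^ (2 * k + 1)) =o[𝓝 0] fun u => u ^ (2 * k) :=
    isLittleO_pow_pow (Nat.lt_succ_self _)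
  refine ((hm.expansion.comp_tendsto hshift).congr (fun u => ?_) fun u => ?_).trans_isLittleO hpow
  · simp only [Function.comp_apply, add_sub_cancel_left]
    ring
  · simp only [Function.comp_apply, add_sub_cancel_left]

theorem IsMinimumOfType.exists_forall_le (hm : IsMinimumOfType g m k lam) :
    ∃ A > 0, A ≤ 1 ∧ ∀ u, |u| ≤ A →
      lam / (2 * k).factorial / 2 * u ^ (2 * k) ≤ g (m + u) - g m := by
  have hcoeff : 0 < lam / (2 * k).factorial / 2 := by
    have := hm.strength_pos
    positivity
  obtain ⟨A, hA, hball⟩ := Metric.eventually_nhds_iff_ball.mp (hm.isLittleO.bound hcoeff)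
  refine ⟨min 1 (A / 2), by positivity, min_le_left _ _, fun u hu => ?_⟩
  have hmem : u ∈ Metric.ball 0 A := by
    rw [mem_ball_zero_iff, Real.norm_eq_abs]
    exact (hu.trans (min_le_right _ _)).trans_lt (half_lt_self hA)
  have hbound := hball u hmem
  rw [Real.norm_eq_abs, Real.norm_of_nonneg ((even_two_mul k).pow_nonneg u)] at hbound
  linear_combination (abs_le.mp hbound).1

theorem IsMinimumOfType.strength_le_of_secondDifference_le (hm : IsMinimumOfType g m 1 lam) {c : ℝ}
    (hc : ∀ᶠ u in 𝓝 0, g (m + u) + g (m - u) - 2 * g m ≤ c * u ^ 2) : lam ≤ c := by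
  refine le_of_forall_pos_le_add fun ε hε => ?_
  have hright := hm.isLittleO.bound (half_pos hε)
  have hleft : ∀ᶠ u : ℝ in 𝓝 0, _ := (continuous_neg.tendsto' (0 : ℝ) 0 neg_zero).eventually hright
  have hall := ((hright.and hleft).and hc).filter_mono (nhdsWithin_le_nhds (s := {0}ᶜ))
  obtain ⟨u, ⟨⟨hr, hl⟩, hu⟩, hu0⟩ := (hall.and self_mem_nhdsWithin).exists
  simp only [mul_one, Nat.factorial_two, Nat.cast_ofNat, Real.norm_eq_abs, abs_pow, sq_abs,
    even_two.neg_pow, ← sub_eq_add_neg] at hr hl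
  have hpos : 0 < u ^ 2 := by
    have : u ≠ 0 := hu0
    positivity
  refine le_of_mul_le_mul_right ?_ hpos
  linear_combination hu + (abs_le.mp hr).1 + (abs_le.mp hl).1

theorem IsMinimumOfType.strength_lt {β : ℝ} (hβ : β ≠ 0) {ν : Measure ℝ} [IsFiniteMeasure ν]
    [NeZero ν] (hν : Integrable (fun y => y) ν) (hm : IsMinimumOfType (G β ν) m 1 lam) :
    lam < β := by
  have hpos : 0 < β ^ 2 / 2 * ∫ y, (Real.cosh (β * (m + y)) ^ 2)⁻¹ ∂ν :=
    mul_pos (by positivity) (integral_inv_cosh_sq_pos m)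
  linarith [hm.strength_le_of_secondDifference_le (eventually_G_secondDifference_le hν m)]

end MinimumOfType

section Concentration

variable {Ω : Type*} [MeasurableSpace Ω] {ν : Measure Ω}

/-- Deviation of the empirical mean of the observable `X` over the first `n` coordinates of a sample
`ω` from its expectation under `ν`. -/
def meanDeviation (ν : Measure Ω) (X : Ω → ℝ) (n : ℕ) (ω : ℕ → Ω) : ℝ :=
  (∑ i ∈ Finset.range n, X (ω i)) / n - ∫ y, X y ∂ν

theorem meanDeviation_neg (X : Ω → ℝ) (n : ℕ) (ω : ℕ → Ω) :
    meanDeviation ν (-X) n ω = -meanDeviation ν X n ω := by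
  simp only [meanDeviation, Pi.neg_apply, Finset.sum_neg_distrib, integral_neg]
  ring

theorem abs_meanDeviation_sub_le [IsProbabilityMeasure ν] {X Y : Ω → ℝ} (hX : Integrable X ν)
    (hY : Integrable Y ν) {c : ℝ} (hXY : ∀ y, |X y - Y y| ≤ c) (n : ℕ) (ω : ℕ → Ω) :
    |meanDeviation ν X n ω - meanDeviation ν Y n ω| ≤ 2 * c := by
  have hc : 0 ≤ c := (abs_nonneg _).trans (hXY (ω 0))
  have hmean : |∫ y, (X y - Y y) ∂ν| ≤ c := by
    simpa using norm_integral_le_of_norm_le_const (μ := ν) (f := fun y => X y - Y y)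
      (Eventually.of_forall hXY)
  have hsum : |∑ i ∈ Finset.range n, (X (ω i) - Y (ω i))| ≤ c * n :=
    calc |∑ i ∈ Finset.range n, (X (ω i) - Y (ω i))|
        ≤ ∑ i ∈ Finset.range n, |X (ω i) - Y (ω i)| := Finset.abs_sum_le_sum_abs _ _
      _ ≤ ∑ _i ∈ Finset.range n, c := Finset.sum_le_sum fun i _ => hXY (ω i)
      _ = c * n := by simp [mul_comm]
  have hsplit : meanDeviation ν X n ω - meanDeviation ν Y n ω =
      (∑ i ∈ Finset.range n, (X (ω i) - Y (ω i))) / n - ∫ y, (X y - Y y) ∂ν := by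
    rw [integral_sub hX hY, Finset.sum_sub_distrib]
    unfold meanDeviation
    ring
  have havg : |(∑ i ∈ Finset.range n, (X (ω i) - Y (ω i))) / n| ≤ c := by
    rw [abs_div, Nat.abs_cast]
    exact div_le_of_le_mul₀ n.cast_nonneg hc hsum
  rw [hsplit]
  linarith [abs_sub ((∑ i ∈ Finset.range n, (X (ω i) - Y (ω i))) / n) (∫ y, (X y - Y y) ∂ν)]

theorem measureReal_le_meanDeviation_le [IsProbabilityMeasure ν] {X : Ω → ℝ} (hX : Measurable X)
    {B : ℝ} (hB : ∀ y, |X y| ≤ B) (n : ℕ) {t : ℝ} (ht : 0 ≤ t) :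
    (Measure.infinitePi fun _ : ℕ => ν).real {ω | t ≤ meanDeviation ν X n ω} ≤
      Real.exp (-(n * t ^ 2 / (2 * B ^ 2))) := by
  rcases eq_or_ne n 0 with rfl | hn
  · simp [measureReal_le_one]
  have hsub (i : ℕ) : HasSubgaussianMGF (fun ω : ℕ → Ω => X (ω i) - ∫ y, X y ∂ν)
      ((‖B - -B‖₊ / 2) ^ 2) (Measure.infinitePi fun _ => ν) := by
    refine HasSubgaussianMGF.of_map (X := fun y => X y - ∫ y, X y ∂ν) (Y := fun ω : ℕ → Ω => ω i)
      (measurable_pi_apply i).aemeasurable ?_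
    rw [Measure.infinitePi_map_eval (fun _ : ℕ => ν) i]
    exact hasSubgaussianMGF_of_mem_Icc hX.aemeasurable
      (Eventually.of_forall fun y => abs_le.mp (hB y))
  have hindep : iIndepFun (fun (i : ℕ) (ω : ℕ → Ω) => X (ω i) - ∫ y, X y ∂ν)
      (Measure.infinitePi fun _ => ν) :=
    iIndepFun_infinitePi (X := fun _ y => X y - ∫ y, X y ∂ν) fun _ => hX.sub_const _
  have hproxy : (((‖B - -B‖₊ / 2) ^ 2 : NNReal) : ℝ) = B ^ 2 := by
    rw [NNReal.coe_pow, NNReal.coe_div, coe_nnnorm, Real.norm_eq_abs, sub_neg_eq_add,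
      ← two_mul, abs_mul, NNReal.coe_ofNat, abs_two, mul_div_cancel_left₀ _ two_ne_zero, sq_abs]
  have hset : {ω | t ≤ meanDeviation ν X n ω} =
      {ω : ℕ → Ω | n * t ≤ ∑ i ∈ Finset.range n, (X (ω i) - ∫ y, X y ∂ν)} := by
    ext ω
    simp only [Set.mem_ofPred_eq, meanDeviation, Finset.sum_sub_distrib, Finset.sum_const,
      Finset.card_range, nsmul_eq_mul]
    rw [le_sub_iff_add_le, le_sub_iff_add_le, le_div_iff₀ (by positivity), ← mul_add, mul_comm]
  rw [hset]
  refine (HasSubgaussianMGF.measure_sum_range_ge_le_of_iIndepFun hindep (fun i _ => hsub i)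
    (mul_nonneg n.cast_nonneg ht)).trans_eq ?_
  rw [hproxy]
  congr 1
  field_simp

theorem measureReal_le_abs_meanDeviation_le [IsProbabilityMeasure ν] {X : Ω → ℝ}
    (hX : Measurable X) {B : ℝ} (hB : ∀ y, |X y| ≤ B) (n : ℕ) {t : ℝ} (ht : 0 ≤ t) :
    (Measure.infinitePi fun _ : ℕ => ν).real {ω | t ≤ |meanDeviation ν X n ω|} ≤
      2 * Real.exp (-(n * t ^ 2 / (2 * B ^ 2))) := by
  have hunion : {ω | t ≤ |meanDeviation ν X n ω|} ⊆
      {ω | t ≤ meanDeviation ν X n ω} ∪ {ω | t ≤ meanDeviation ν (-X) n ω} := fun ω hω => by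
    simpa only [Set.mem_union, Set.mem_ofPred_eq, meanDeviation_neg] using le_abs.mp hω
  rw [two_mul]
  exact (measureReal_mono hunion).trans <| (measureReal_union_le _ _).trans <|
    add_le_add (measureReal_le_meanDeviation_le hX hB n ht)
      (measureReal_le_meanDeviation_le hX.neg (by simpa using hB) n ht)

/-- A family of observables that is Lipschitz in its parameter, uniformly over the sample space, and
vanishes at the parameter `0`. -/
structure IsLipschitzFamily (X : ℝ → Ω → ℝ) (L : ℝ) : Prop where
  measurable (u : ℝ) : Measurable (X u)
  apply_zero (y : Ω) : X 0 y = 0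
  abs_sub_le (u v : ℝ) (y : Ω) : |X u y - X v y| ≤ L * |u - v|

namespace IsLipschitzFamily

variable {X : ℝ → Ω → ℝ} {L : ℝ}

theorem abs_le (hX : IsLipschitzFamily X L) (u : ℝ) (y : Ω) : |X u y| ≤ L * |u| := by
  simpa [hX.apply_zero] using hX.abs_sub_le u 0 y

theorem integrable [IsFiniteMeasure ν] (hX : IsLipschitzFamily X L) (u : ℝ) :
    Integrable (X u) ν :=
  .of_bound (hX.measurable u).aestronglyMeasurable (L * |u|) (.of_forall (hX.abs_le u))

end IsLipschitzFamily

/-- The event that the empirical mean of `X u` deviates atypically at the grid point `u = j / n`;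
the summand `1 / n` keeps the threshold positive at `j = 0`. -/
def gridDeviation (ν : Measure Ω) (X : ℝ → Ω → ℝ) (L : ℝ) (n : ℕ) (j : ℤ) : Set (ℕ → Ω) :=
  {ω | L * (|(j : ℝ) / n| + 1 / n) * √(6 * (Real.log n / n)) ≤ |meanDeviation ν (X (j / n)) n ω|}

theorem measureReal_gridDeviation_le [IsProbabilityMeasure ν] {X : ℝ → Ω → ℝ} {L : ℝ}
    (hX : IsLipschitzFamily X L) (hL : 0 < L) {n : ℕ} (hn : n ≠ 0) (j : ℤ) :
    (Measure.infinitePi fun _ : ℕ => ν).real (gridDeviation ν X L n j) ≤ 2 / (n : ℝ) ^ 3 := by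
  have hn' : (0 : ℝ) < n := by positivity
  have hbound (y : Ω) : |X (j / n) y| ≤ L * (|(j : ℝ) / n| + 1 / n) :=
    (hX.abs_le _ y).trans (by gcongr; exact le_add_of_nonneg_right (by positivity))
  refine (measureReal_le_abs_meanDeviation_le (hX.measurable _) hbound n
    (by positivity)).trans_eq ?_
  have hexponent : n * (L * (|(j : ℝ) / n| + 1 / n) * √(6 * (Real.log n / n))) ^ 2 /
      (2 * (L * (|(j : ℝ) / n| + 1 / n)) ^ 2) = (3 : ℕ) * Real.log n := by
    have hpos : 0 < L * (|(j : ℝ) / n| + 1 / n) := by positivity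
    generalize L * (|(j : ℝ) / n| + 1 / n) = B at hpos
    rw [mul_pow, Real.sq_sqrt (by positivity)]
    push_cast
    field_simp
    ring
  rw [hexponent, Real.exp_neg, Real.exp_nat_mul, Real.exp_log hn', div_eq_mul_inv]

theorem card_Icc_neg_self (n : ℕ) : ((Finset.Icc (-(n : ℤ)) n).card : ℝ) = 2 * n + 1 := by
  rw [Int.card_Icc, show ((n : ℤ) + 1 - -(n : ℤ)).toNat = 2 * n + 1 by omega]
  push_cast
  ring

theorem measureReal_biUnion_gridDeviation_le [IsProbabilityMeasure ν] {X : ℝ → Ω → ℝ} {L : ℝ}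
    (hX : IsLipschitzFamily X L) (hL : 0 < L) {n : ℕ} (hn : n ≠ 0) :
    (Measure.infinitePi fun _ : ℕ => ν).real
      (⋃ j ∈ Finset.Icc (-(n : ℤ)) n, gridDeviation ν X L n j) ≤ 6 * ((n : ℝ) ^ 2)⁻¹ := by
  have hn' : (1 : ℝ) ≤ n := mod_cast Nat.one_le_iff_ne_zero.mpr hn
  calc (Measure.infinitePi fun _ : ℕ => ν).real
        (⋃ j ∈ Finset.Icc (-(n : ℤ)) n, gridDeviation ν X L n j)
      ≤ ∑ j ∈ Finset.Icc (-(n : ℤ)) n,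
          (Measure.infinitePi fun _ : ℕ => ν).real (gridDeviation ν X L n j) :=
        measureReal_biUnion_finset_le _ _
    _ ≤ (Finset.Icc (-(n : ℤ)) n).card • (2 / (n : ℝ) ^ 3) :=
        Finset.sum_le_card_nsmul _ _ _ fun j _ => measureReal_gridDeviation_le hX hL hn j
    _ = (2 * n + 1) * (2 / (n : ℝ) ^ 3) := by rw [nsmul_eq_mul, card_Icc_neg_self]
    _ ≤ (3 * n) * (2 / (n : ℝ) ^ 3) := by gcongr; linarith
    _ = 6 * ((n : ℝ) ^ 2)⁻¹ := by field_simp; norm_num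

theorem ae_eventually_notMem_gridDeviation [IsProbabilityMeasure ν] {X : ℝ → Ω → ℝ} {L : ℝ}
    (hX : IsLipschitzFamily X L) (hL : 0 < L) :
    ∀ᵐ ω ∂(Measure.infinitePi fun _ : ℕ => ν), ∀ᶠ n : ℕ in atTop,
      ∀ j ∈ Finset.Icc (-(n : ℤ)) n, ω ∉ gridDeviation ν X L n j := by
  let bad (n : ℕ) : Set (ℕ → Ω) := ⋃ j ∈ Finset.Icc (-(n : ℤ)) n, gridDeviation ν X L n j
  have hsum : ∑' n, (Measure.infinitePi fun _ : ℕ => ν) (bad (n + 1)) ≠ ∞ := by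
    have hsummable : Summable fun n : ℕ => 6 * (((n + 1 : ℕ) : ℝ) ^ 2)⁻¹ :=
      ((summable_nat_add_iff 1).mpr (Real.summable_nat_pow_inv.mpr one_lt_two)).mul_left 6
    refine ne_top_of_le_ne_top hsummable.tsum_ofReal_ne_top (ENNReal.tsum_le_tsum fun n => ?_)
    rw [← ofReal_measureReal (measure_ne_top _ _)]
    exact ENNReal.ofReal_le_ofReal (measureReal_biUnion_gridDeviation_le hX hL n.succ_ne_zero)
  filter_upwards [ae_eventually_notMem hsum] with ω hω
  have hshift : ∀ᶠ n in atTop, ω ∉ bad n := by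
    rwa [← map_add_atTop_eq_nat 1, eventually_map]
  simpa only [bad, Set.mem_iUnion₂, not_exists] using hshift

theorem exists_grid_point {n : ℕ} (hn : n ≠ 0) {u : ℝ} (hu : |u| ≤ 1) :
    ∃ j ∈ Finset.Icc (-(n : ℤ)) n, |u - j / n| ≤ 1 / n := by
  obtain ⟨hu₁, hu₂⟩ := _root_.abs_le.mp hu
  refine ⟨⌊u * n⌋, Finset.mem_Icc.mpr ⟨Int.le_floor.mpr ?_, Int.floor_le_iff.mpr ?_⟩, ?_⟩
  · push_cast
    nlinarith
  · push_cast
    nlinarith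
  · rw [show u - (⌊u * n⌋ : ℝ) / n = Int.fract (u * n) / n by rw [Int.fract]; field_simp,
      abs_div, Nat.abs_cast, Int.abs_fract]
    gcongr
    exact (Int.fract_lt_one _).le

theorem log_div_self_le_one {n : ℕ} : Real.log n / n ≤ 1 :=
  div_le_one_of_le₀ (Real.log_le_self n.cast_nonneg) n.cast_nonneg

theorem abs_meanDeviation_le_of_notMem_gridDeviation [IsProbabilityMeasure ν] {X : ℝ → Ω → ℝ}
    {L : ℝ} (hX : IsLipschitzFamily X L) (hL : 0 < L) {n : ℕ} (hn : n ≠ 0) {ω : ℕ → Ω}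
    (hω : ∀ j ∈ Finset.Icc (-(n : ℤ)) n, ω ∉ gridDeviation ν X L n j) {u : ℝ} (hu : |u| ≤ 1) :
    |meanDeviation ν (X u) n ω| ≤ 8 * L * (|u| * √(Real.log n / n) + 1 / n) := by
  obtain ⟨j, hj, hju⟩ := exists_grid_point hn hu
  have hgrid : |meanDeviation ν (X (j / n)) n ω| <
      L * (|(j : ℝ) / n| + 1 / n) * √(6 * (Real.log n / n)) := not_le.mp (hω j hj)
  have hclose : |meanDeviation ν (X u) n ω - meanDeviation ν (X (j / n)) n ω| ≤
      2 * (L * |u - j / n|) :=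
    abs_meanDeviation_sub_le (hX.integrable _) (hX.integrable _) (hX.abs_sub_le _ _) n ω
  have habs : |(j : ℝ) / n| ≤ |u| + 1 / n := by
    have := abs_sub_abs_le_abs_sub ((j : ℝ) / n) u
    rw [abs_sub_comm] at this
    linarith
  have hsqrt : √(6 * (Real.log n / n)) ≤ 3 * √(Real.log n / n) := by
    rw [Real.sqrt_mul (by norm_num)]
    gcongr
    exact Real.sqrt_le_iff.mpr (by norm_num)
  have hsmall : √(Real.log n / n) ≤ 1 := Real.sqrt_le_one.mpr log_div_self_le_one
  calc |meanDeviation ν (X u) n ω|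
      ≤ |meanDeviation ν (X (j / n)) n ω| +
          |meanDeviation ν (X u) n ω - meanDeviation ν (X (j / n)) n ω| := by
        linarith [abs_sub_abs_le_abs_sub (meanDeviation ν (X u) n ω)
          (meanDeviation ν (X (j / n)) n ω)]
    _ ≤ L * ((|u| + 1 / n) + 1 / n) * (3 * √(Real.log n / n)) + 2 * (L * (1 / n)) := by
        refine add_le_add (hgrid.le.trans ?_) (hclose.trans ?_) <;> gcongr
    _ = L * (3 * (|u| * √(Real.log n / n)) + 6 * (1 / n * √(Real.log n / n)) + 2 * (1 / n)) := by
        ring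
    _ ≤ L * (8 * (|u| * √(Real.log n / n)) + 6 * (1 / n * 1) + 2 * (1 / n)) := by
        gcongr
        norm_num
    _ = 8 * L * (|u| * √(Real.log n / n) + 1 / n) := by ring

theorem ae_eventually_abs_meanDeviation_le [IsProbabilityMeasure ν] {X : ℝ → Ω → ℝ} {L : ℝ}
    (hX : IsLipschitzFamily X L) (hL : 0 < L) :
    ∀ᵐ ω ∂(Measure.infinitePi fun _ : ℕ => ν), ∀ᶠ n : ℕ in atTop, ∀ u : ℝ, |u| ≤ 1 →
      |meanDeviation ν (X u) n ω| ≤ 8 * L * (|u| * √(Real.log n / n) + 1 / n) := by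
  filter_upwards [ae_eventually_notMem_gridDeviation hX hL] with ω hω
  filter_upwards [hω, eventually_ne_atTop 0] with n hn hn0 u hu
  exact abs_meanDeviation_le_of_notMem_gridDeviation hX hL hn0 hn hu

end Concentration

section TypicalField

/-- The empirical counterpart of `G`, in which the law of the field is replaced by the empirical
measure of its first `n` values. -/
def empiricalG (β : ℝ) (h : ℕ → ℝ) (n : ℕ) (x : ℝ) : ℝ :=
  β / 2 * x ^ 2 - (∑ i : Fin n, Real.log (Real.cosh (β * (x + h i)))) / n

/-- Increment of `ln cosh (β (· + y))` from `m` to `m + u`. -/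
def logCoshIncrement (β m u y : ℝ) : ℝ :=
  Real.log (Real.cosh (β * (m + u + y))) - Real.log (Real.cosh (β * (m + y)))

theorem isLipschitzFamily_logCoshIncrement {β : ℝ} (hβ : 0 ≤ β) (m : ℝ) :
    IsLipschitzFamily (logCoshIncrement β m) β where
  measurable u := by
    unfold logCoshIncrement
    fun_prop
  apply_zero y := by simp [logCoshIncrement]
  abs_sub_le u v y := by
    have hlip := lipschitzWith_log_cosh.dist_le_mul (β * (m + u + y)) (β * (m + v + y))
    rw [NNReal.coe_one, one_mul, Real.dist_eq, Real.dist_eq, ← mul_sub, abs_mul,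
      abs_of_nonneg hβ] at hlip
    simpa [logCoshIncrement] using hlip

/-- The field `h` is typical at `m` if the increments of `empiricalG` from `m` are uniformly close
to those of `G`; the fluctuations have order `|u| √(ln n / n)`, and `1 / n` is a discretization
error. -/
def IsTypicalField (β : ℝ) (ν : Measure ℝ) (m : ℝ) (h : ℕ → ℝ) : Prop :=
  ∃ K, ∀ᶠ n : ℕ in atTop, ∀ u : ℝ, |u| ≤ 1 →
    |(empiricalG β h n (m + u) - empiricalG β h n m) - (G β ν (m + u) - G β ν m)| ≤
      K * (|u| * √(Real.log n / n) + 1 / n)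

variable {β : ℝ} {ν : Measure ℝ}

theorem empiricalG_increment_sub_G_increment [IsFiniteMeasure ν]
    (hν : Integrable (fun y => y) ν) (m u : ℝ) (h : ℕ → ℝ) (n : ℕ) :
    (empiricalG β h n (m + u) - empiricalG β h n m) - (G β ν (m + u) - G β ν m) =
      -meanDeviation ν (logCoshIncrement β m u) n h := by
  unfold meanDeviation logCoshIncrement empiricalG G
  rw [integral_sub (integrable_log_cosh_mul_add hν β _) (integrable_log_cosh_mul_add hν β _),
    Finset.sum_sub_distrib, Finset.sum_range, Finset.sum_range]
  ring

theorem ae_isTypicalField (hβ : 0 < β) [IsProbabilityMeasure ν]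
    (hν : Integrable (fun y => y) ν) (m : ℝ) : ∀ᵐ h ∂(fieldLaw ν), IsTypicalField β ν m h := by
  filter_upwards [ae_eventually_abs_meanDeviation_le
    (isLipschitzFamily_logCoshIncrement hβ.le m) hβ] with h hh
  refine ⟨8 * β, hh.mono fun n hn u hu => ?_⟩
  rw [empiricalG_increment_sub_G_increment hν, abs_neg]
  exact hn u hu

end TypicalField

/-- Spatial scale `n ^ (α - 1)` of the magnetization per spin. -/
def scale (α : ℝ) (n : ℕ) : ℝ := (n : ℝ) ^ (α - 1)

/-- Speed `n ^ (1 - 2 k (1 - α))` of the moderate deviations principle. -/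
def speed (k : ℕ) (α : ℝ) (n : ℕ) : ℝ := (n : ℝ) ^ (1 - 2 * (k : ℝ) * (1 - α))

section Scales

variable {k : ℕ} {α : ℝ} {n : ℕ}

theorem scale_pos (α : ℝ) (hn : n ≠ 0) : 0 < scale α n :=
  Real.rpow_pos_of_pos (by positivity) _

theorem speed_pos (k : ℕ) (α : ℝ) (hn : n ≠ 0) : 0 < speed k α n :=
  Real.rpow_pos_of_pos (by positivity) _

theorem speed_eq (k : ℕ) (α : ℝ) (hn : n ≠ 0) : speed k α n = n * scale α n ^ (2 * k) := by
  have hn' : (0 : ℝ) < n := by positivity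
  have hexponent : 1 - 2 * (k : ℝ) * (1 - α) = 1 + (α - 1) * (2 * k : ℕ) := by
    push_cast
    ring
  rw [speed, hexponent, Real.rpow_add hn', Real.rpow_one, Real.rpow_mul_natCast hn'.le, scale]

theorem rpow_eq_mul_scale (α : ℝ) (hn : n ≠ 0) : (n : ℝ) ^ α = n * scale α n := by
  have hn' : (0 : ℝ) < n := by positivity
  rw [scale, Real.rpow_sub_one hn'.ne', mul_div_cancel₀ _ hn'.ne']

/-- The range of `α` in which fluctuations of the field of order `√(n ln n)` are negligible at the
speed belonging to type `k`. -/
structure IsModerateExponent (k : ℕ) (α : ℝ) : Prop where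
  one_le : 1 ≤ k
  lt : 1 - 1 / (2 * (2 * (k : ℝ) - 1)) < α
  lt_one : α < 1

namespace IsModerateExponent

theorem mul_lt (hα : IsModerateExponent k α) : (2 * (k : ℝ) - 1) * (1 - α) < 1 / 2 := by
  have hk : (1 : ℝ) ≤ k := mod_cast hα.one_le
  have hlt : 1 - α < 1 / (2 * (2 * (k : ℝ) - 1)) := by linarith [hα.lt]
  rw [lt_div_iff₀ (by linarith)] at hlt
  linarith

theorem half_lt (hα : IsModerateExponent k α) : 1 / 2 < α := by
  have hk : (1 : ℝ) ≤ k := mod_cast hα.one_le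
  nlinarith [hα.mul_lt, hα.lt_one]

theorem one (hα : IsModerateExponent k α) : IsModerateExponent 1 α where
  one_le := le_rfl
  lt := by
    rw [Nat.cast_one]
    linarith [hα.half_lt]
  lt_one := hα.lt_one

theorem speed_exponent_pos (hα : IsModerateExponent k α) : 0 < 1 - 2 * (k : ℝ) * (1 - α) := by
  nlinarith [hα.mul_lt, hα.half_lt]

theorem tendsto_scale (hα : IsModerateExponent k α) : Tendsto (scale α) atTop (𝓝 0) := by
  refine ((tendsto_rpow_neg_atTop (sub_pos.mpr hα.lt_one)).comp
    (tendsto_natCast_atTop_atTop (R := ℝ))).congr fun n => ?_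
  rw [Function.comp_apply, neg_sub, scale]

theorem eventually_abs_scale_mul_lt (hα : IsModerateExponent k α) (R : ℝ) {δ : ℝ} (hδ : 0 < δ) :
    ∀ᶠ n in atTop, ∀ z, |z| ≤ R → |scale α n * z| < δ := by
  have hlim : Tendsto (fun n => |scale α n| * R) atTop (𝓝 0) := by
    simpa using hα.tendsto_scale.abs.mul_const R
  filter_upwards [hlim.eventually (eventually_lt_nhds hδ)] with n hn z hz
  rw [abs_mul]
  exact (mul_le_mul_of_nonneg_left hz (abs_nonneg _)).trans_lt hn

theorem tendsto_speed (hα : IsModerateExponent k α) : Tendsto (speed k α) atTop atTop :=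
  (tendsto_rpow_atTop hα.speed_exponent_pos).comp tendsto_natCast_atTop_atTop

theorem eventually_le_speed (hα : IsModerateExponent k α) {η : ℝ} (hη : 0 < η) (C : ℝ) :
    ∀ᶠ n in atTop, C ≤ η * speed k α n :=
  (hα.tendsto_speed.const_mul_atTop hη).eventually_ge_atTop C

theorem eventually_speed_le_speed_one (hα : IsModerateExponent k α) (hk : k ≠ 1) {η : ℝ}
    (hη : 0 < η) : ∀ᶠ n in atTop, speed k α n ≤ η * speed 1 α n := by
  have hk' : 2 * (k - 1) ≠ 0 := by have := hα.one_le; omega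
  have hpow : Tendsto (fun n => scale α n ^ (2 * (k - 1))) atTop (𝓝 0) := by
    simpa [hk'] using hα.tendsto_scale.pow (2 * (k - 1))
  filter_upwards [hpow.eventually (eventually_le_nhds hη), eventually_ne_atTop 0] with n hn hn0
  have hsplit : 2 * k = 2 * (k - 1) + 2 * 1 := by have := hα.one_le; omega
  rw [speed_eq k α hn0, hsplit, pow_add, mul_left_comm, ← speed_eq 1 α hn0]
  exact mul_le_mul_of_nonneg_right hn (speed_pos 1 α hn0).le

theorem eventually_log_le (hα : IsModerateExponent k α) {η : ℝ} (hη : 0 < η) :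
    ∀ᶠ n : ℕ in atTop, Real.log (2 * n + 1) ≤ η * speed k α n := by
  have hlog := (tendsto_natCast_atTop_atTop (R := ℝ)).eventually
    ((isLittleO_log_rpow_atTop hα.speed_exponent_pos).bound (half_pos hη))
  filter_upwards [hlog, hα.eventually_le_speed (half_pos hη) (Real.log 3),
    eventually_ge_atTop 1] with n hn h3 hn1
  have hn' : (1 : ℝ) ≤ n := mod_cast hn1
  rw [Real.norm_of_nonneg (Real.log_natCast_nonneg n), Real.norm_of_nonneg (by positivity)] at hn
  calc Real.log (2 * n + 1) ≤ Real.log (3 * n) := by gcongr; linarith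
    _ = Real.log 3 + Real.log n := Real.log_mul (by norm_num) (by positivity)
    _ ≤ η / 2 * speed k α n + η / 2 * speed k α n := add_le_add h3 hn
    _ = η * speed k α n := by ring

theorem eventually_fluctuation_le (hα : IsModerateExponent k α) {η : ℝ} (hη : 0 < η) :
    ∀ᶠ n : ℕ in atTop, n * scale α n * √(Real.log n / n) ≤ η * speed k α n := by
  have hexponent : 0 < 1 / 2 - (2 * (k : ℝ) - 1) * (1 - α) := by linarith [hα.mul_lt]
  have hlog := (tendsto_natCast_atTop_atTop (R := ℝ)).eventually
    ((isLittleO_log_rpow_rpow_atTop (1 / 2) hexponent).bound hη)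
  filter_upwards [hlog, eventually_ne_atTop 0] with n hn hn0
  have hn' : (0 : ℝ) < n := by positivity
  have hlog0 := Real.log_natCast_nonneg n
  rw [Real.norm_of_nonneg (by positivity), Real.norm_of_nonneg (by positivity)] at hn
  calc n * scale α n * √(Real.log n / n)
      = (n : ℝ) ^ (α - 1 / 2) * Real.log n ^ (1 / 2 : ℝ) := by
        rw [← rpow_eq_mul_scale α hn0, Real.sqrt_div hlog0, Real.sqrt_eq_rpow, Real.sqrt_eq_rpow,
          Real.rpow_sub hn']
        ring
    _ ≤ (n : ℝ) ^ (α - 1 / 2) * (η * (n : ℝ) ^ (1 / 2 - (2 * (k : ℝ) - 1) * (1 - α))) := by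
        gcongr
    _ = η * speed k α n := by
        rw [speed, mul_left_comm, ← Real.rpow_add hn']
        ring_nf

end IsModerateExponent

end Scales

section ScaledIncrements

/-- The increment of `n g` from `m` to `m + n ^ (α - 1) z`. -/
def scaledIncrement (g : ℝ → ℝ) (m α : ℝ) (n : ℕ) (z : ℝ) : ℝ :=
  n * (g (m + scale α n * z) - g m)

/-- On the scale `n ^ (α - 1)` the functions `n F n` look like `speed k α n * (κ z ^ (2 k))` around
`m`, locally uniformly in `z`. -/
def HasScaledExpansion (F : ℕ → ℝ → ℝ) (m α κ : ℝ) (k : ℕ) : Prop :=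
  ∀ R η : ℝ, 0 < η → ∀ᶠ n in atTop, ∀ z, |z| ≤ R →
    |scaledIncrement (F n) m α n z - speed k α n * (κ * z ^ (2 * k))| ≤ η * speed k α n

/-- Within distance `A` of `m`, but outside its `n ^ (α - 1)`-neighbourhood, the increments of
`n F n` from `m` grow at least linearly in the scaled variable. -/
def HasScaledGrowth (F : ℕ → ℝ → ℝ) (m α A b : ℝ) (k : ℕ) : Prop :=
  ∀ᶠ n in atTop, ∀ z, 1 ≤ |z| → |scale α n * z| ≤ A →
    speed k α n * (b * |z|) ≤ scaledIncrement (F n) m α n z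

variable {g : ℝ → ℝ} {m α κ : ℝ} {k : ℕ}

theorem natCast_mul_scale_mul_pow {n : ℕ} (hn : n ≠ 0) (z : ℝ) :
    n * (scale α n * z) ^ (2 * k) = speed k α n * z ^ (2 * k) := by
  rw [mul_pow, ← mul_assoc, ← speed_eq k α hn]

theorem hasScaledExpansion_of_isLittleO
    (hg : (fun u => g (m + u) - g m - κ * u ^ (2 * k)) =o[𝓝 0] fun u => u ^ (2 * k))
    (hα : IsModerateExponent k α) : HasScaledExpansion (fun _ => g) m α κ k := by
  intro R η hη
  obtain ⟨δ, hδ, hball⟩ := Metric.eventually_nhds_iff_ball.mp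
    (hg.bound (c := η / (|R| ^ (2 * k) + 1)) (by positivity))
  filter_upwards [hα.eventually_abs_scale_mul_lt R hδ, eventually_ne_atTop 0] with n hn hn0 z hz
  have hz' : |z| ≤ |R| := hz.trans (le_abs_self R)
  have hpow : z ^ (2 * k) ≤ |R| ^ (2 * k) + 1 := by
    rw [← (even_two_mul k).pow_abs]
    linarith [pow_le_pow_left₀ (abs_nonneg z) hz' (2 * k)]
  have hbound := hball _ (mem_ball_zero_iff.mpr (hn z hz))
  rw [Real.norm_eq_abs, Real.norm_of_nonneg ((even_two_mul k).pow_nonneg _)] at hbound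
  calc |scaledIncrement g m α n z - speed k α n * (κ * z ^ (2 * k))|
      = n * |g (m + scale α n * z) - g m - κ * (scale α n * z) ^ (2 * k)| := by
        rw [scaledIncrement, mul_left_comm, ← natCast_mul_scale_mul_pow hn0, mul_left_comm,
          ← mul_sub, abs_mul, Nat.abs_cast]
    _ ≤ n * (η / (|R| ^ (2 * k) + 1) * (scale α n * z) ^ (2 * k)) := by gcongr
    _ = η / (|R| ^ (2 * k) + 1) * (speed k α n * z ^ (2 * k)) := by
        rw [mul_left_comm, natCast_mul_scale_mul_pow hn0]
    _ ≤ η / (|R| ^ (2 * k) + 1) * (speed k α n * (|R| ^ (2 * k) + 1)) := by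
        have := (speed_pos k α hn0).le
        gcongr
    _ = η * speed k α n := by field_simp

theorem HasScaledExpansion.quadratic {F : ℕ → ℝ → ℝ} (hF : HasScaledExpansion F m α κ k)
    (hα : IsModerateExponent k α) :
    HasScaledExpansion F m α (if k = 1 then κ else 0) 1 := by
  split_ifs with hk
  · exact hk ▸ hF
  intro R η hη
  have hC : 0 < |κ| * |R| ^ (2 * k) + 1 := by positivity
  filter_upwards [hF R 1 one_pos, hα.eventually_speed_le_speed_one hk (div_pos hη hC),
    eventually_ne_atTop 0] with n hn hspeed hn0 z hz
  have hpow : |κ * z ^ (2 * k)| ≤ |κ| * |R| ^ (2 * k) := by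
    have hz' : |z| ≤ |R| := hz.trans (le_abs_self R)
    rw [abs_mul, abs_pow]
    gcongr
  have hs := (speed_pos k α hn0).le
  have htriangle := abs_sub_abs_le_abs_sub (scaledIncrement (F n) m α n z)
    (speed k α n * (κ * z ^ (2 * k)))
  rw [zero_mul, mul_zero, sub_zero]
  calc |scaledIncrement (F n) m α n z|
      ≤ |speed k α n * (κ * z ^ (2 * k))| + 1 * speed k α n := by linarith [hn z hz]
    _ ≤ speed k α n * (|κ| * |R| ^ (2 * k)) + 1 * speed k α n := by
        rw [abs_mul, abs_of_nonneg hs]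
        gcongr
    _ = (|κ| * |R| ^ (2 * k) + 1) * speed k α n := by ring
    _ ≤ (|κ| * |R| ^ (2 * k) + 1) * (η / (|κ| * |R| ^ (2 * k) + 1) * speed 1 α n) := by gcongr
    _ = η * speed 1 α n := by field_simp

variable {β : ℝ} {ν : Measure ℝ} {h : ℕ → ℝ}

theorem IsTypicalField.eventually_abs_scaledIncrement_sub_le (hh : IsTypicalField β ν m h)
    (hα : IsModerateExponent k α) {η : ℝ} (hη : 0 < η) :
    ∀ᶠ n in atTop, ∀ z, |scale α n * z| ≤ 1 →
      |scaledIncrement (empiricalG β h n) m α n z - scaledIncrement (G β ν) m α n z| ≤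
        η * speed k α n * (|z| + 1) := by
  obtain ⟨K, hK⟩ := hh
  have hK0 : 0 < |K| + 1 := by positivity
  filter_upwards [hK, hα.eventually_fluctuation_le (div_pos hη hK0),
    hα.eventually_le_speed hη (|K| + 1), eventually_ne_atTop 0] with n hn hfluct hone hn0 z hz
  have hle : K ≤ |K| + 1 := (le_abs_self K).trans (lt_add_one _).le
  calc |scaledIncrement (empiricalG β h n) m α n z - scaledIncrement (G β ν) m α n z|
      = n * |(empiricalG β h n (m + scale α n * z) - empiricalG β h n m) -
          (G β ν (m + scale α n * z) - G β ν m)| := by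
        rw [scaledIncrement, scaledIncrement, ← mul_sub, abs_mul, Nat.abs_cast]
    _ ≤ n * ((|K| + 1) * (|scale α n * z| * √(Real.log n / n) + 1 / n)) := by
        gcongr
        exact (hn _ hz).trans (by gcongr)
    _ = (|K| + 1) * (n * scale α n * √(Real.log n / n)) * |z| + (|K| + 1) := by
        rw [abs_mul, abs_of_pos (scale_pos α hn0)]
        field_simp
    _ ≤ (|K| + 1) * (η / (|K| + 1) * speed k α n) * |z| + η * speed k α n := by gcongr
    _ = η * speed k α n * (|z| + 1) := by field_simp

theorem IsTypicalField.hasScaledExpansion (hh : IsTypicalField β ν m h)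
    (hα : IsModerateExponent k α) (hG : HasScaledExpansion (fun _ => G β ν) m α κ k) :
    HasScaledExpansion (empiricalG β h) m α κ k := by
  intro R η hη
  have hη' : 0 < η / 2 / (|R| + 1) := by positivity
  filter_upwards [hG R (η / 2) (half_pos hη), hα.eventually_abs_scale_mul_lt R one_pos,
    hh.eventually_abs_scaledIncrement_sub_le hα hη', eventually_ne_atTop 0]
    with n hGn hn hclose hn0 z hz
  have hz' : |z| ≤ |R| := hz.trans (le_abs_self R)
  have hs := (speed_pos k α hn0).le
  calc |scaledIncrement (empiricalG β h n) m α n z - speed k α n * (κ * z ^ (2 * k))|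
      ≤ |scaledIncrement (empiricalG β h n) m α n z - scaledIncrement (G β ν) m α n z| +
          |scaledIncrement (G β ν) m α n z - speed k α n * (κ * z ^ (2 * k))| :=
        abs_sub_le _ _ _
    _ ≤ η / 2 / (|R| + 1) * speed k α n * (|R| + 1) + η / 2 * speed k α n :=
        add_le_add ((hclose z (hn z hz).le).trans (by gcongr)) (hGn z hz)
    _ = η * speed k α n := by
        field_simp
        ring

theorem IsTypicalField.hasScaledGrowth (hh : IsTypicalField β ν m h)
    (hα : IsModerateExponent k α) (hκ : 0 < κ) {A : ℝ} (hA : A ≤ 1)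
    (hG : ∀ u, |u| ≤ A → κ * u ^ (2 * k) ≤ G β ν (m + u) - G β ν m) :
    HasScaledGrowth (empiricalG β h) m α A (κ / 2) k := by
  have hk : 2 * k ≠ 0 := by have := hα.one_le; omega
  filter_upwards [hh.eventually_abs_scaledIncrement_sub_le hα (η := κ / 4) (by positivity),
    eventually_ne_atTop 0] with n hclose hn0 z hz1 hzA
  have hs := (speed_pos k α hn0).le
  have hpow : |z| ≤ z ^ (2 * k) := by
    rw [← (even_two_mul k).pow_abs]
    exact le_self_pow₀ hz1 hk
  have hmean : speed k α n * (κ * |z|) ≤ scaledIncrement (G β ν) m α n z :=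
    calc speed k α n * (κ * |z|) ≤ speed k α n * (κ * z ^ (2 * k)) := by gcongr
      _ = n * (κ * (scale α n * z) ^ (2 * k)) := by
          rw [mul_left_comm, mul_left_comm _ κ, natCast_mul_scale_mul_pow hn0]
      _ ≤ scaledIncrement (G β ν) m α n z :=
          mul_le_mul_of_nonneg_left (hG _ hzA) n.cast_nonneg
  have hfluct : κ / 4 * speed k α n * (|z| + 1) ≤ κ / 4 * speed k α n * (2 * |z|) := by
    gcongr
    linarith
  linarith [(abs_le.mp (hclose z (hzA.trans hA))).1]

end ScaledIncrements

section MassOn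

variable {ι : Type*} [Fintype ι] {p q : ι → ℝ} {U V : Set ι}

/-- Total mass that the weights `p` put on `U`. -/
def massOn (p : ι → ℝ) (U : Set ι) : ℝ := ∑ i, U.indicator p i

theorem massOn_univ (p : ι → ℝ) : massOn p Set.univ = ∑ i, p i := by
  simp only [massOn, Set.indicator_univ]

theorem massOn_mono (hp : 0 ≤ p) (hUV : U ⊆ V) : massOn p U ≤ massOn p V :=
  Finset.sum_le_sum fun i _ => Set.indicator_le_indicator_of_subset hUV hp i

theorem massOn_const_mul (c : ℝ) (p : ι → ℝ) (U : Set ι) :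
    massOn (fun i => c * p i) U = c * massOn p U := by
  simp only [massOn, Set.indicator_const_mul, Finset.mul_sum]

theorem massOn_le_massOn (h : ∀ i ∈ U, p i ≤ q i) : massOn p U ≤ massOn q U :=
  Finset.sum_le_sum fun _ _ => Set.indicator_le_indicator' (h _)

theorem massOn_le_of_le_const_mul {C : ℝ} (hC : 0 ≤ C) (hq : 0 ≤ q) (hq1 : ∑ i, q i = 1)
    (hpq : ∀ i ∈ U, p i ≤ C * q i) : massOn p U ≤ C :=
  calc massOn p U ≤ C * massOn q U := massOn_const_mul C q U ▸ massOn_le_massOn hpq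
    _ ≤ C * massOn q Set.univ := by
        gcongr
        exact massOn_mono hq (Set.subset_univ U)
    _ = C := by rw [massOn_univ, hq1, mul_one]

theorem massOn_biUnion_le {κ : Type*} (hp : 0 ≤ p) (s : Finset κ) (W : κ → Set ι) :
    massOn p (⋃ j ∈ s, W j) ≤ ∑ j ∈ s, massOn p (W j) := by
  unfold massOn
  rw [Finset.sum_comm]
  refine Finset.sum_le_sum fun i _ => ?_
  have hnonneg (j : κ) : 0 ≤ (W j).indicator p i := Set.indicator_nonneg (fun i _ => hp i) i
  by_cases hi : i ∈ ⋃ j ∈ s, W j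
  · obtain ⟨j, hj, hij⟩ := Set.mem_iUnion₂.mp hi
    rw [Set.indicator_of_mem hi, ← Set.indicator_of_mem hij p]
    exact Finset.single_le_sum (f := fun j => (W j).indicator p i) (fun j _ => hnonneg j) hj
  · rw [Set.indicator_of_notMem hi]
    exact Finset.sum_nonneg fun j _ => hnonneg j

theorem massOn_union_le (hp : 0 ≤ p) (U V : Set ι) :
    massOn p (U ∪ V) ≤ massOn p U + massOn p V := by
  simpa [Set.union_eq_iUnion] using massOn_biUnion_le hp Finset.univ fun b => cond b U V

end MassOn

section Tilting

/-- Product measure on configurations under which spin `i` feels the field `x + h i`. -/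
def tilt (β : ℝ) (h : ℕ → ℝ) (x : ℝ) {n : ℕ} (σ : Config n) : ℝ :=
  ∏ i : Fin n, Real.exp (β * (x + h i) * ((σ i : ℤ) : ℝ)) / (2 * Real.cosh (β * (x + h i)))

/-- The random variable whose conditional law is `conditionedLaw`. -/
def scaledMagnetization (m α : ℝ) {n : ℕ} (σ : Config n) : ℝ :=
  (magnetization σ - n * m) / (n : ℝ) ^ α

/-- The factor of `weight_eq_baseWeight_mul` that does not depend on the configuration. -/
def baseWeight (β : ℝ) (h : ℕ → ℝ) (m : ℝ) (n : ℕ) : ℝ :=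
  2 ^ n * Real.exp (-(n * empiricalG β h n m))

/-- Exponential cost, relative to `baseWeight`, of the scaled magnetization `z` when the
configurations are weighted by `tilt` at `m + n ^ (α - 1) w`. -/
def tiltCost (β : ℝ) (h : ℕ → ℝ) (m α : ℝ) (n : ℕ) (w z : ℝ) : ℝ :=
  scaledIncrement (empiricalG β h n) m α n w - speed 1 α n * (β / 2 * (z - w) ^ 2)

variable {β : ℝ} {h : ℕ → ℝ} {m α : ℝ} {n : ℕ}

theorem tilt_nonneg (β : ℝ) (h : ℕ → ℝ) (x : ℝ) : 0 ≤ tilt β h x (n := n) :=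
  fun _ => Finset.prod_nonneg fun _ _ => by positivity

theorem sum_tilt (β : ℝ) (h : ℕ → ℝ) (x : ℝ) (n : ℕ) : ∑ σ : Config n, tilt β h x σ = 1 := by
  have hspin (b : ℝ) : ∑ s : ({-1, 1} : Finset ℤ),
      Real.exp (b * ((s : ℤ) : ℝ)) / (2 * Real.cosh b) = 1 := by
    rw [Finset.sum_coe_sort ({-1, 1} : Finset ℤ) fun s : ℤ =>
        Real.exp (b * (s : ℝ)) / (2 * Real.cosh b),
      Finset.sum_pair (by norm_num), ← add_div, div_eq_one_iff_eq (by positivity), Real.cosh_eq]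
    push_cast
    ring_nf
  unfold tilt
  rw [← Fintype.prod_sum fun (i : Fin n) (s : ({-1, 1} : Finset ℤ)) =>
    Real.exp (β * (x + h i) * ((s : ℤ) : ℝ)) / (2 * Real.cosh (β * (x + h i)))]
  exact Finset.prod_eq_one fun i _ => hspin _

theorem weight_nonneg (β : ℝ) (h : ℕ → ℝ) : 0 ≤ weight β h (n := n) :=
  fun _ => (Real.exp_pos _).le

theorem baseWeight_pos (β : ℝ) (h : ℕ → ℝ) (m : ℝ) (n : ℕ) : 0 < baseWeight β h m n :=
  mul_pos (by positivity) (Real.exp_pos _)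

theorem two_pow_mul_tilt (β : ℝ) (h : ℕ → ℝ) (x : ℝ) (σ : Config n) :
    2 ^ n * tilt β h x σ =
      Real.exp (β * x * magnetization σ + β * ∑ i : Fin n, h i * ((σ i : ℤ) : ℝ) -
        ∑ i : Fin n, Real.log (Real.cosh (β * (x + h i)))) := by
  have htwo : (2 : ℝ) ^ n = ∏ _i : Fin n, (2 : ℝ) := by simp
  unfold tilt magnetization
  rw [htwo, ← Finset.prod_mul_distrib, Finset.mul_sum, Finset.mul_sum, ← Finset.sum_add_distrib,
    ← Finset.sum_sub_distrib, Real.exp_sum]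
  refine Finset.prod_congr rfl fun i _ => ?_
  rw [Real.exp_sub, Real.exp_log (Real.cosh_pos _), ← mul_div_assoc,
    mul_div_mul_left _ _ two_ne_zero]
  ring_nf

theorem weight_eq (hn : n ≠ 0) (β : ℝ) (h : ℕ → ℝ) (x : ℝ) (σ : Config n) :
    weight β h σ = 2 ^ n * Real.exp (-(n * empiricalG β h n x) +
      n * (β / 2 * (magnetization σ / n - x) ^ 2)) * tilt β h x σ := by
  rw [mul_right_comm, two_pow_mul_tilt, ← Real.exp_add, weight]
  congr 1
  unfold empiricalG
  field_simp
  ring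

theorem magnetization_div_sub (hn : n ≠ 0) (m α w : ℝ) (σ : Config n) :
    magnetization σ / n - (m + scale α n * w) = scale α n * (scaledMagnetization m α σ - w) := by
  have hs := scale_pos α hn
  rw [scaledMagnetization, rpow_eq_mul_scale α hn]
  field_simp
  ring

theorem weight_eq_baseWeight_mul (hn : n ≠ 0) (β : ℝ) (h : ℕ → ℝ) (m α w : ℝ) (σ : Config n) :
    weight β h σ = baseWeight β h m n *
      Real.exp (-tiltCost β h m α n w (scaledMagnetization m α σ)) *
        tilt β h (m + scale α n * w) σ := by
  rw [weight_eq hn β h (m + scale α n * w), magnetization_div_sub hn, baseWeight,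
    mul_assoc (2 ^ n) (Real.exp (-(n * empiricalG β h n m))), ← Real.exp_add, tiltCost,
    scaledIncrement, speed_eq 1 α hn]
  congr 3
  ring

theorem tilt_eq (hn : n ≠ 0) (β : ℝ) (h : ℕ → ℝ) (m α w w' : ℝ) (σ : Config n) :
    tilt β h (m + scale α n * w) σ =
      Real.exp (tiltCost β h m α n w (scaledMagnetization m α σ) -
        tiltCost β h m α n w' (scaledMagnetization m α σ)) *
          tilt β h (m + scale α n * w') σ := by
  have hweight := (weight_eq_baseWeight_mul hn β h m α w σ).symm.trans
    (weight_eq_baseWeight_mul hn β h m α w' σ)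
  rw [mul_assoc, mul_assoc] at hweight
  have hcancel := mul_left_cancel₀ (baseWeight_pos β h m n).ne' hweight
  rw [sub_eq_add_neg, Real.exp_add, mul_assoc, ← hcancel, ← mul_assoc, ← Real.exp_add,
    add_neg_cancel, Real.exp_zero, one_mul]

theorem massOn_tilt_le (hn : n ≠ 0) {U : Set (Config n)} {w b : ℝ} (w' : ℝ)
    (hU : ∀ σ ∈ U, b ≤ tiltCost β h m α n w' (scaledMagnetization m α σ) -
      tiltCost β h m α n w (scaledMagnetization m α σ)) :
    massOn (tilt β h (m + scale α n * w)) U ≤ Real.exp (-b) := by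
  refine massOn_le_of_le_const_mul (Real.exp_pos _).le (tilt_nonneg β h _)
    (sum_tilt β h (m + scale α n * w') n) fun σ hσ => ?_
  rw [tilt_eq hn β h m α w w']
  have htilt := tilt_nonneg β h (m + scale α n * w') σ
  gcongr
  linarith [hU σ hσ]

theorem massOn_weight_le_of_forall (hn : n ≠ 0) {U : Set (Config n)} {w b : ℝ}
    (hU : ∀ σ ∈ U, b ≤ tiltCost β h m α n w (scaledMagnetization m α σ)) :
    massOn (weight β h) U ≤ baseWeight β h m n * Real.exp (-b) := by
  have hbase := (baseWeight_pos β h m n).le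
  refine massOn_le_of_le_const_mul (by positivity) (tilt_nonneg β h _)
    (sum_tilt β h (m + scale α n * w) n) fun σ hσ => ?_
  rw [weight_eq_baseWeight_mul hn β h m α w]
  have htilt := tilt_nonneg β h (m + scale α n * w) σ
  have hcost := hU σ hσ
  gcongr

theorem le_massOn_weight (hn : n ≠ 0) {U : Set (Config n)} {w b : ℝ}
    (hU : ∀ σ ∈ U, tiltCost β h m α n w (scaledMagnetization m α σ) ≤ b) :
    baseWeight β h m n * Real.exp (-b) * massOn (tilt β h (m + scale α n * w)) U ≤
      massOn (weight β h) U := by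
  rw [← massOn_const_mul]
  refine massOn_le_massOn fun σ hσ => ?_
  rw [weight_eq_baseWeight_mul hn β h m α w]
  have htilt := tilt_nonneg β h (m + scale α n * w) σ
  have hbase := (baseWeight_pos β h m n).le
  have hcost := hU σ hσ
  gcongr

theorem exists_magnetization_eq_intCast (σ : Config n) :
    ∃ s ∈ Finset.Icc (-(n : ℤ)) n, magnetization σ = s := by
  have hspin (i : Fin n) : |(σ i : ℤ)| ≤ 1 := by
    have hmem := (σ i).2
    rw [Finset.mem_insert, Finset.mem_singleton] at hmem
    rcases hmem with hi | hi <;> simp [hi]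
  have hsum : |∑ i, (σ i : ℤ)| ≤ n :=
    calc |∑ i, (σ i : ℤ)| ≤ ∑ i, |(σ i : ℤ)| := Finset.abs_sum_le_sum_abs _ _
      _ ≤ ∑ _i : Fin n, 1 := Finset.sum_le_sum fun i _ => hspin i
      _ = n := by simp
  exact ⟨∑ i, (σ i : ℤ), Finset.mem_Icc.mpr (abs_le.mp hsum), by simp [magnetization]⟩

theorem massOn_weight_le (hn : n ≠ 0) {U : Set (Config n)} {b : ℝ}
    (hU : ∀ σ ∈ U, ∃ w, b ≤ tiltCost β h m α n w (scaledMagnetization m α σ)) :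
    massOn (weight β h) U ≤ (2 * n + 1) * (baseWeight β h m n * Real.exp (-b)) := by
  let fiber (s : ℤ) : Set (Config n) := {σ ∈ U | magnetization σ = s}
  have hcover : U ⊆ ⋃ s ∈ Finset.Icc (-(n : ℤ)) n, fiber s := fun σ hσ => by
    obtain ⟨s, hs, hσs⟩ := exists_magnetization_eq_intCast σ
    exact Set.mem_biUnion hs ⟨hσ, hσs⟩
  have hfiber (s : ℤ) : massOn (weight β h) (fiber s) ≤ baseWeight β h m n * Real.exp (-b) := by
    rcases (fiber s).eq_empty_or_nonempty with hempty | ⟨τ, hτ, hτs⟩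
    · exact massOn_weight_le_of_forall (m := m) (α := α) (w := 0) hn (by simp [hempty])
    · obtain ⟨w, hw⟩ := hU τ hτ
      refine massOn_weight_le_of_forall (m := m) (α := α) (w := w) hn fun σ hσ => ?_
      rwa [scaledMagnetization, hσ.2, ← hτs]
  calc massOn (weight β h) U
      ≤ massOn (weight β h) (⋃ s ∈ Finset.Icc (-(n : ℤ)) n, fiber s) :=
        massOn_mono (weight_nonneg β h) hcover
    _ ≤ ∑ s ∈ Finset.Icc (-(n : ℤ)) n, massOn (weight β h) (fiber s) :=
        massOn_biUnion_le (weight_nonneg β h) _ _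
    _ ≤ (Finset.Icc (-(n : ℤ)) n).card • (baseWeight β h m n * Real.exp (-b)) :=
        Finset.sum_le_card_nsmul _ _ _ fun s _ => hfiber s
    _ = (2 * n + 1) * (baseWeight β h m n * Real.exp (-b)) := by
        rw [nsmul_eq_mul, card_Icc_neg_self]

end Tilting

section OptimalTilt

/-- Stationarity at `w = c z` of the leading order `w ↦ q w² - β / 2 (z - w)²` of `tiltCost` when
the increments of `n G` look like `κ w ^ (2 k)`: the quadratic coefficient `q` is `κ` if `k = 1`,
and `0` otherwise. Under the tilt at `m + n ^ (α - 1) c z` the scaled magnetization is about `z`. -/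
def IsOptimalTilt (β κ c : ℝ) (k : ℕ) : Prop :=
  2 * (if k = 1 then κ else 0) * c = β * (c - 1)

/-- Leading order of `tiltCost` at `w = c z`. -/
def tiltedRate (β κ c : ℝ) (k : ℕ) (z : ℝ) : ℝ :=
  κ * (c * z) ^ (2 * k) - β / 2 * ((1 - c) * z) ^ 2

/-- Configurations whose magnetization per spin is within distance `a` of `m`. -/
def window (m a : ℝ) (n : ℕ) : Set (Config n) :=
  {σ | magnetization σ / n ∈ Set.Icc (m - a) (m + a)}

variable {β κ c : ℝ} {k : ℕ} {h : ℕ → ℝ} {m α : ℝ}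

theorem mem_window_iff {n : ℕ} (hn : n ≠ 0) (α : ℝ) {a : ℝ} {σ : Config n} :
    σ ∈ window m a n ↔ |scale α n * scaledMagnetization m α σ| ≤ a := by
  have hdiff := magnetization_div_sub hn m α 0 σ
  rw [mul_zero, add_zero, sub_zero] at hdiff
  rw [← hdiff, abs_sub_comm]
  exact Set.mem_Icc_iff_abs_le.symm

theorem tiltCost_self (β : ℝ) (h : ℕ → ℝ) (m α : ℝ) (n : ℕ) (z : ℝ) :
    tiltCost β h m α n z z = scaledIncrement (empiricalG β h n) m α n z := by
  simp [tiltCost]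

theorem IsOptimalTilt.speed_one_mul_sub (hc : IsOptimalTilt β κ c k) (hβ : 0 < β) (α : ℝ)
    (n : ℕ) : speed 1 α n * (1 - c) = speed k α n * (1 - c) := by
  by_cases hk : k = 1
  · rw [hk]
  · have hc1 : c - 1 = 0 := by simpa [IsOptimalTilt, hk, hβ.ne'] using hc
    rw [← neg_sub c, hc1, neg_zero, mul_zero, mul_zero]

theorem IsOptimalTilt.eventually_abs_tiltCost_sub_le (hc : IsOptimalTilt β κ c k) (hβ : 0 < β)
    (hexp : HasScaledExpansion (empiricalG β h) m α κ k) (R : ℝ) {η : ℝ} (hη : 0 < η) :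
    ∀ᶠ n in atTop, ∀ z, |z| ≤ R →
      |tiltCost β h m α n (c * z) z - speed k α n * tiltedRate β κ c k z| ≤ η * speed k α n := by
  filter_upwards [hexp (|c| * R) η hη] with n hn z hz
  have hcz : |c * z| ≤ |c| * R := by
    rw [abs_mul]
    gcongr
  refine (congrArg _ ?_).trans_le (hn (c * z) hcz)
  rw [tiltCost, tiltedRate]
  linear_combination -(β / 2 * (1 - c) * z ^ 2) * hc.speed_one_mul_sub hβ α n

theorem IsOptimalTilt.tiltCost_le_add (hc : IsOptimalTilt β κ c k) (hβ : 0 < β) {n : ℕ}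
    (hn : n ≠ 0) (z₀ z : ℝ) : tiltCost β h m α n (c * z₀) z ≤
      tiltCost β h m α n (c * z₀) z₀ + speed k α n * (β * |(1 - c) * z₀| * |z - z₀|) := by
  have hspeed := hc.speed_one_mul_sub hβ α n
  have hsq : 0 ≤ speed 1 α n * (β / 2 * (z - z₀) ^ 2) :=
    mul_nonneg (speed_pos 1 α hn).le (by positivity)
  have hcross : speed k α n * (β * -((1 - c) * z₀ * (z - z₀))) ≤
      speed k α n * (β * |(1 - c) * z₀| * |z - z₀|) := by
    rw [mul_assoc β, ← abs_mul]
    have := (speed_pos k α hn).le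
    gcongr
    exact neg_le_abs _
  unfold tiltCost
  linear_combination hsq + hcross - β * z₀ * (z - z₀) * hspeed

/-- Moving the tilt by `s` towards `z` raises the cost to leading order by
`s β (z - z₀) + (q - β / 2) s²`: stationarity removes the dependence on `c`. -/
theorem IsOptimalTilt.eventually_le_tiltCost_sub (hc : IsOptimalTilt β κ c k) (hβ : 0 < β)
    (hκ : 0 ≤ κ) (hα : IsModerateExponent k α)
    (hexp : HasScaledExpansion (empiricalG β h) m α κ k) (z₀ : ℝ) {s : ℝ} (hs : s ≠ 0) :
    ∀ᶠ n in atTop, ∀ z, s ^ 2 ≤ s * (z - z₀) → β / 4 * s ^ 2 * speed 1 α n ≤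
      tiltCost β h m α n (c * z₀ + s) z - tiltCost β h m α n (c * z₀) z := by
  have hη : 0 < β / 8 * s ^ 2 := by positivity
  filter_upwards [hexp.quadratic hα (|c * z₀| + |s|) _ hη, eventually_ne_atTop 0]
    with n hn hn0 z hz
  have hspeed := speed_pos 1 α hn0
  have hmoved := (abs_le.mp (hn (c * z₀ + s) (abs_add_le _ _))).1
  have hcentre := (abs_le.mp (hn (c * z₀) (le_add_of_nonneg_right (abs_nonneg s)))).2
  have hq : 0 ≤ if k = 1 then κ else 0 := by split_ifs <;> simp [hκ]
  unfold IsOptimalTilt at hc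
  set q := if k = 1 then κ else 0
  have hgain : β / 2 * s ^ 2 * speed 1 α n ≤ speed 1 α n * (q * (c * z₀ + s) ^ 2 -
      q * (c * z₀) ^ 2 - β / 2 * (z - (c * z₀ + s)) ^ 2 + β / 2 * (z - c * z₀) ^ 2) := by
    rw [mul_comm]
    gcongr
    linear_combination β * hz + mul_nonneg hq (sq_nonneg s) - z₀ * s * hc
  rw [mul_one] at hmoved hcentre
  unfold tiltCost
  linear_combination hgain + hmoved + hcentre

theorem IsOptimalTilt.eventually_massOn_tilt_le_quarter (hc : IsOptimalTilt β κ c k)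
    (hβ : 0 < β) (hκ : 0 ≤ κ) (hα : IsModerateExponent k α)
    (hexp : HasScaledExpansion (empiricalG β h) m α κ k) (z₀ : ℝ) {s : ℝ} (hs : s ≠ 0) :
    ∀ᶠ n in atTop, massOn (tilt β h (m + scale α n * (c * z₀)))
      {σ : Config n | s ^ 2 ≤ s * (scaledMagnetization m α σ - z₀)} ≤ 1 / 4 := by
  have hrate : 0 < β / 4 * s ^ 2 := by positivity
  filter_upwards [hc.eventually_le_tiltCost_sub hβ hκ hα hexp z₀ hs,
    hα.one.eventually_le_speed hrate (Real.log 4), eventually_ne_atTop 0] with n hn hlog hn0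
  calc massOn (tilt β h (m + scale α n * (c * z₀))) _
      ≤ Real.exp (-(β / 4 * s ^ 2 * speed 1 α n)) :=
        massOn_tilt_le hn0 (c * z₀ + s) fun _ hσ => hn _ hσ
    _ ≤ Real.exp (-Real.log 4) := by gcongr
    _ = 1 / 4 := by rw [Real.exp_neg, Real.exp_log (by norm_num), one_div]

theorem IsOptimalTilt.eventually_half_le_massOn_tilt (hc : IsOptimalTilt β κ c k)
    (hβ : 0 < β) (hκ : 0 ≤ κ) (hα : IsModerateExponent k α)
    (hexp : HasScaledExpansion (empiricalG β h) m α κ k) (z₀ : ℝ) {δ : ℝ} (hδ : 0 < δ) :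
    ∀ᶠ n in atTop, 1 / 2 ≤ massOn (tilt β h (m + scale α n * (c * z₀)))
      {σ : Config n | |scaledMagnetization m α σ - z₀| < δ} := by
  filter_upwards [hc.eventually_massOn_tilt_le_quarter hβ hκ hα hexp z₀ hδ.ne',
    hc.eventually_massOn_tilt_le_quarter hβ hκ hα hexp z₀ (neg_ne_zero.mpr hδ.ne')]
    with n hright hleft
  have htilt := tilt_nonneg β h (m + scale α n * (c * z₀)) (n := n)
  let tail (s : ℝ) : Set (Config n) := {σ | s ^ 2 ≤ s * (scaledMagnetization m α σ - z₀)}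
  have hcover : Set.univ ⊆
      {σ : Config n | |scaledMagnetization m α σ - z₀| < δ} ∪ (tail δ ∪ tail (-δ)) := by
    intro σ _
    rcases lt_or_ge |scaledMagnetization m α σ - z₀| δ with hlt | hge
    · exact Or.inl hlt
    · rcases le_abs.mp hge with hpos | hneg
      · exact Or.inr (Or.inl (by rw [Set.mem_ofPred_eq]; nlinarith))
      · exact Or.inr (Or.inr (by rw [Set.mem_ofPred_eq]; nlinarith))
  have htotal := (massOn_univ _).trans (sum_tilt β h (m + scale α n * (c * z₀)) n)
  have hunion := massOn_union_le htilt {σ : Config n | |scaledMagnetization m α σ - z₀| < δ}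
    (tail δ ∪ tail (-δ))
  linarith [massOn_mono htilt hcover, massOn_union_le htilt (tail δ) (tail (-δ))]

theorem IsOptimalTilt.eventually_massOn_weight_le (hc : IsOptimalTilt β κ c k) (hβ : 0 < β)
    (hα : IsModerateExponent k α) (hexp : HasScaledExpansion (empiricalG β h) m α κ k)
    {A b : ℝ} (hb : 0 < b) (hgrowth : HasScaledGrowth (empiricalG β h) m α A b k)
    {C : Set ℝ} {M η : ℝ} (hM : ∀ z ∈ C, M ≤ tiltedRate β κ c k z) (hη : 0 < η) :
    ∀ᶠ n in atTop, massOn (weight β h) (window m A n ∩ scaledMagnetization m α ⁻¹' C) ≤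
      baseWeight β h m n * Real.exp (-(speed k α n * (M - η))) := by
  filter_upwards [hc.eventually_abs_tiltCost_sub_le hβ hexp (|M| / b + 1) (half_pos hη), hgrowth,
    hα.eventually_log_le (half_pos hη), eventually_ne_atTop 0] with n hnear hfar hlog hn0
  have hspeed := speed_pos k α hn0
  have hcost : ∀ σ ∈ window m A n ∩ scaledMagnetization m α ⁻¹' C,
      ∃ w, speed k α n * (M - η / 2) ≤ tiltCost β h m α n w (scaledMagnetization m α σ) := by
    rintro σ ⟨hσA, hσC⟩
    set z := scaledMagnetization m α σ
    rcases le_total |z| (|M| / b + 1) with hz | hz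
    · have hrate := mul_le_mul_of_nonneg_left (hM z hσC) hspeed.le
      exact ⟨c * z, by linarith [(abs_le.mp (hnear z hz)).1]⟩
    · have hMz : M ≤ b * |z| :=
        calc M ≤ b * (|M| / b) := (le_abs_self M).trans_eq (mul_div_cancel₀ _ hb.ne').symm
          _ ≤ b * |z| := by gcongr; linarith
      have hz1 : 1 ≤ |z| := le_trans (le_add_of_nonneg_left (by positivity)) hz
      refine ⟨z, ?_⟩
      calc speed k α n * (M - η / 2) ≤ speed k α n * (b * |z|) := by gcongr; linarith
        _ ≤ tiltCost β h m α n z z :=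
          tiltCost_self β h m α n z ▸ hfar z hz1 ((mem_window_iff hn0 α).mp hσA)
  have hbase := (baseWeight_pos β h m n).le
  calc massOn (weight β h) (window m A n ∩ scaledMagnetization m α ⁻¹' C)
      ≤ (2 * n + 1) * (baseWeight β h m n * Real.exp (-(speed k α n * (M - η / 2)))) :=
        massOn_weight_le hn0 hcost
    _ ≤ Real.exp (η / 2 * speed k α n) *
          (baseWeight β h m n * Real.exp (-(speed k α n * (M - η / 2)))) := by
        gcongr
        exact (Real.log_le_iff_le_exp (by positivity)).mp hlog
    _ = baseWeight β h m n * Real.exp (-(speed k α n * (M - η))) := by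
        rw [mul_left_comm, ← Real.exp_add]
        ring_nf

theorem IsOptimalTilt.exists_eventually_tiltCost_le (hc : IsOptimalTilt β κ c k) (hβ : 0 < β)
    (hexp : HasScaledExpansion (empiricalG β h) m α κ k) (z₀ : ℝ) {η : ℝ} (hη : 0 < η) :
    ∃ ε > 0, ∀ᶠ n in atTop, ∀ z, |z - z₀| < ε →
      tiltCost β h m α n (c * z₀) z ≤ speed k α n * (tiltedRate β κ c k z₀ + η) := by
  have hB : 0 < β * |(1 - c) * z₀| + 1 := by positivity
  refine ⟨η / 2 / (β * |(1 - c) * z₀| + 1), by positivity, ?_⟩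
  filter_upwards [hc.eventually_abs_tiltCost_sub_le hβ hexp |z₀| (half_pos hη),
    eventually_ne_atTop 0] with n hcentre hn0 z hz
  have hspeed := (speed_pos k α hn0).le
  have hshift : β * |(1 - c) * z₀| * |z - z₀| ≤ η / 2 :=
    calc β * |(1 - c) * z₀| * |z - z₀|
        ≤ (β * |(1 - c) * z₀| + 1) * (η / 2 / (β * |(1 - c) * z₀| + 1)) := by
          gcongr
          linarith
      _ = η / 2 := mul_div_cancel₀ _ hB.ne'
  calc tiltCost β h m α n (c * z₀) z
      ≤ tiltCost β h m α n (c * z₀) z₀ + speed k α n * (β * |(1 - c) * z₀| * |z - z₀|) :=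
        hc.tiltCost_le_add hβ hn0 z₀ z
    _ ≤ tiltCost β h m α n (c * z₀) z₀ + speed k α n * (η / 2) := by gcongr
    _ ≤ speed k α n * (tiltedRate β κ c k z₀ + η) := by
        linarith [(abs_le.mp (hcentre z₀ le_rfl)).2]

theorem IsOptimalTilt.eventually_le_massOn_weight (hc : IsOptimalTilt β κ c k) (hβ : 0 < β)
    (hκ : 0 ≤ κ) (hα : IsModerateExponent k α)
    (hexp : HasScaledExpansion (empiricalG β h) m α κ k) {a : ℝ} (ha : 0 < a) (z₀ : ℝ)
    {δ η : ℝ} (hδ : 0 < δ) (hη : 0 < η) :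
    ∀ᶠ n in atTop, baseWeight β h m n * Real.exp (-(speed k α n * (tiltedRate β κ c k z₀ + η))) ≤
      massOn (weight β h) (window m a n ∩ scaledMagnetization m α ⁻¹' Metric.ball z₀ δ) := by
  obtain ⟨ε₀, hε₀, hcost⟩ := hc.exists_eventually_tiltCost_le hβ hexp z₀ (half_pos hη)
  let ε := min δ ε₀
  filter_upwards [hcost, hc.eventually_half_le_massOn_tilt hβ hκ hα hexp z₀ (lt_min hδ hε₀),
    hα.eventually_abs_scale_mul_lt (|z₀| + ε) ha,
    hα.eventually_le_speed (half_pos hη) (Real.log 2), eventually_ne_atTop 0]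
    with n hcost hhalf hwindow hlog hn0
  have hbase := (baseWeight_pos β h m n).le
  let near : Set (Config n) := {σ | |scaledMagnetization m α σ - z₀| < ε}
  have hnear : near ⊆ window m a n ∩ scaledMagnetization m α ⁻¹' Metric.ball z₀ δ := by
    intro σ (hσ : |scaledMagnetization m α σ - z₀| < ε)
    refine ⟨(mem_window_iff hn0 α).mpr (hwindow _ ?_).le, ?_⟩
    · linarith [abs_sub_abs_le_abs_sub (scaledMagnetization m α σ) z₀]
    · exact mem_ball_iff_norm.mpr (hσ.trans_le (min_le_left _ _))
  calc baseWeight β h m n * Real.exp (-(speed k α n * (tiltedRate β κ c k z₀ + η)))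
      = baseWeight β h m n * Real.exp (-(speed k α n * (tiltedRate β κ c k z₀ + η / 2))) *
          Real.exp (-(η / 2 * speed k α n)) := by
        rw [mul_assoc, ← Real.exp_add]
        ring_nf
    _ ≤ baseWeight β h m n * Real.exp (-(speed k α n * (tiltedRate β κ c k z₀ + η / 2))) *
          massOn (tilt β h (m + scale α n * (c * z₀))) near := by
        gcongr
        refine le_trans ?_ hhalf
        rw [Real.exp_neg, one_div]
        exact inv_anti₀ two_pos ((Real.log_le_iff_le_exp two_pos).mp hlog)
    _ ≤ massOn (weight β h) near :=
        le_massOn_weight hn0 fun σ hσ => hcost _ (lt_of_lt_of_le hσ (min_le_right _ _))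
    _ ≤ massOn (weight β h) (window m a n ∩ scaledMagnetization m α ⁻¹' Metric.ball z₀ δ) :=
        massOn_mono (weight_nonneg β h) hnear

end OptimalTilt

section LargeDeviations

theorem le_log_div {p : ℝ≥0∞} {s t : ℝ} (hs : 0 < s)
    (hp : ENNReal.ofReal (Real.exp (s * t)) ≤ p) : (t : EReal) ≤ ENNReal.log p / (s : EReal) := by
  rw [EReal.le_div_iff_mul_le (mod_cast hs) (EReal.coe_ne_top s)]
  refine le_trans ?_ (ENNReal.log_le_log hp)
  rw [ENNReal.log_ofReal_of_pos (Real.exp_pos _), Real.log_exp, mul_comm, EReal.coe_mul]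

theorem log_div_le {p : ℝ≥0∞} {s t : ℝ} (hs : 0 < s)
    (hp : p ≤ ENNReal.ofReal (Real.exp (s * t))) : ENNReal.log p / (s : EReal) ≤ t := by
  rw [EReal.div_le_iff_le_mul (mod_cast hs) (EReal.coe_ne_top s)]
  refine (ENNReal.log_le_log hp).trans ?_
  rw [ENNReal.log_ofReal_of_pos (Real.exp_pos _), Real.log_exp, EReal.coe_mul]

variable {P : ℕ → Measure ℝ} {a : ℕ → ℝ} {I : ℝ → ℝ}

theorem neg_iInf_interior_le_liminf (ha : ∀ᶠ n in atTop, 0 < a n)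
    (hlower : ∀ z δ η : ℝ, 0 < δ → 0 < η → ∀ᶠ n in atTop,
      ENNReal.ofReal (Real.exp (a n * -(I z + η))) ≤ P n (Metric.ball z δ)) (C : Set ℝ) :
    -(⨅ x ∈ interior C, (I x : EReal)) ≤
      liminf (fun n => ENNReal.log (P n C) / (a n : EReal)) atTop := by
  rw [EReal.neg_le]
  refine le_iInf₂ fun z hz => ?_
  rw [EReal.neg_le, ← EReal.ge_of_forall_gt_iff_ge]
  intro t ht
  have ht : t < -I z := mod_cast ht
  obtain ⟨δ, hδ, hball⟩ := Metric.isOpen_iff.mp isOpen_interior z hz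
  refine le_liminf_of_le (by isBoundedDefault) ?_
  filter_upwards [ha, hlower z δ (-I z - t) hδ (by linarith)] with n han hn
  refine le_log_div han (le_trans ?_ (hn.trans (measure_mono (hball.trans interior_subset))))
  rw [show -(I z + (-I z - t)) = t by ring]

theorem limsup_le_neg_iInf_closure (ha : ∀ᶠ n in atTop, 0 < a n) {C : Set ℝ}
    (hupper : ∀ M η : ℝ, (∀ z ∈ C, M ≤ I z) → 0 < η → ∀ᶠ n in atTop,
      P n C ≤ ENNReal.ofReal (Real.exp (a n * -(M - η)))) :
    limsup (fun n => ENNReal.log (P n C) / (a n : EReal)) atTop ≤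
      -(⨅ x ∈ closure C, (I x : EReal)) := by
  rw [← EReal.le_of_forall_lt_iff_le]
  intro t ht
  obtain ⟨t', hlt, hlt'⟩ := EReal.lt_iff_exists_real_btwn.mp ht
  have hlt' : t' < t := mod_cast hlt'
  have hM : ∀ z ∈ C, -t' ≤ I z := fun z hz => by
    have hinf : ((-t' : ℝ) : EReal) ≤ ⨅ x ∈ closure C, (I x : EReal) := by
      rw [EReal.coe_neg]
      exact EReal.neg_le.mp hlt.le
    exact mod_cast hinf.trans (iInf₂_le z (subset_closure hz))
  refine limsup_le_of_le (by isBoundedDefault) ?_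
  filter_upwards [ha, hupper (-t') (t - t') hM (by linarith)] with n han hn
  refine log_div_le han (hn.trans_eq ?_)
  rw [neg_sub, sub_neg_eq_add, sub_add_cancel]

theorem isCompact_setOf_mul_pow_le {w : ℝ} (hw : 0 < w) {k : ℕ} (hk : k ≠ 0) (c : ℝ) :
    IsCompact {x : ℝ | w * x ^ (2 * k) ≤ c} := by
  refine (isCompact_Icc (a := -max 1 (c / w)) (b := max 1 (c / w))).of_isClosed_subset
    (isClosed_le (by fun_prop) continuous_const) fun x hx => ?_
  rw [Set.mem_Icc, ← abs_le]
  rcases le_total |x| 1 with hx1 | hx1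
  · exact hx1.trans (le_max_left _ _)
  · calc |x| ≤ |x| ^ (2 * k) := le_self_pow₀ hx1 (by omega)
      _ = x ^ (2 * k) := (even_two_mul k).pow_abs x
      _ ≤ c / w := (le_div_iff₀' hw).mpr hx
      _ ≤ max 1 (c / w) := le_max_right _ _

end LargeDeviations

section ConditionedLaw

variable {β κ c : ℝ} {k n : ℕ} {h : ℕ → ℝ} {m α a b : ℝ}

theorem partitionFunction_pos (β : ℝ) (h : ℕ → ℝ) (n : ℕ) : 0 < partitionFunction β h n :=
  Finset.sum_pos (fun _ _ => Real.exp_pos _) ⟨fun _ => ⟨1, by simp⟩, Finset.mem_univ _⟩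

theorem gibbs_apply (β : ℝ) (h : ℕ → ℝ) (U : Set (Config n)) :
    gibbs β h n U = ENNReal.ofReal (massOn (weight β h) U / partitionFunction β h n) := by
  have hZ := (partitionFunction_pos β h n).le
  have hnonneg (σ : Config n) : 0 ≤ U.indicator (weight β h) σ :=
    Set.indicator_nonneg (fun τ _ => weight_nonneg β h τ) σ
  rw [gibbs, massOn, Measure.coe_finsetSum, Finset.sum_apply, Finset.sum_div,
    ENNReal.ofReal_sum_of_nonneg fun σ _ => div_nonneg (hnonneg σ) hZ]
  refine Finset.sum_congr rfl fun σ _ => ?_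
  rw [Measure.smul_apply, Measure.dirac_apply' _ U.toFinite.measurableSet, smul_eq_mul]
  by_cases hσ : σ ∈ U <;> simp [hσ]

theorem conditionedLaw_apply (β : ℝ) (h : ℕ → ℝ) (m α : ℝ) {C : Set ℝ} (hC : MeasurableSet C)
    (hpos : 0 < massOn (weight β h) (window m a n)) :
    conditionedLaw β h m a α n C = ENNReal.ofReal
      (massOn (weight β h) (window m a n ∩ scaledMagnetization m α ⁻¹' C) /
        massOn (weight β h) (window m a n)) := by
  have hZ := partitionFunction_pos β h n
  have hmeas : Measurable (scaledMagnetization m α (n := n)) := measurable_of_finite _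
  change Measure.map (scaledMagnetization m α) (cond (gibbs β h n) (window m a n)) C = _
  rw [Measure.map_apply hmeas hC, cond_apply (Set.toFinite _).measurableSet, gibbs_apply,
    gibbs_apply, ← ENNReal.ofReal_inv_of_pos (div_pos hpos hZ),
    ← ENNReal.ofReal_mul (inv_nonneg.mpr (div_pos hpos hZ).le)]
  congr 1
  field_simp

theorem tiltedRate_zero (β κ c : ℝ) (hk : k ≠ 0) : tiltedRate β κ c k 0 = 0 := by
  simp [tiltedRate, hk]

theorem IsOptimalTilt.eventually_le_massOn_window (hc : IsOptimalTilt β κ c k) (hβ : 0 < β)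
    (hκ : 0 ≤ κ) (hα : IsModerateExponent k α)
    (hexp : HasScaledExpansion (empiricalG β h) m α κ k) (ha : 0 < a) {η : ℝ} (hη : 0 < η) :
    ∀ᶠ n in atTop, baseWeight β h m n * Real.exp (-(speed k α n * η)) ≤
      massOn (weight β h) (window m a n) := by
  have hk : k ≠ 0 := by have := hα.one_le; omega
  filter_upwards [hc.eventually_le_massOn_weight hβ hκ hα hexp ha 0 one_pos hη] with n hn
  rw [tiltedRate_zero β κ c hk, zero_add] at hn
  exact hn.trans (massOn_mono (weight_nonneg β h) Set.inter_subset_left)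

theorem IsOptimalTilt.eventually_massOn_window_pos (hc : IsOptimalTilt β κ c k) (hβ : 0 < β)
    (hκ : 0 ≤ κ) (hα : IsModerateExponent k α)
    (hexp : HasScaledExpansion (empiricalG β h) m α κ k) (ha : 0 < a) :
    ∀ᶠ n in atTop, 0 < massOn (weight β h) (window m a n) := by
  filter_upwards [hc.eventually_le_massOn_window hβ hκ hα hexp ha one_pos] with n hn
  exact (mul_pos (baseWeight_pos β h m n) (Real.exp_pos _)).trans_le hn

theorem IsOptimalTilt.eventually_conditionedLaw_le (hc : IsOptimalTilt β κ c k) (hβ : 0 < β)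
    (hκ : 0 ≤ κ) (hα : IsModerateExponent k α)
    (hexp : HasScaledExpansion (empiricalG β h) m α κ k) (ha : 0 < a) (hb : 0 < b)
    (hgrowth : HasScaledGrowth (empiricalG β h) m α a b k) {C : Set ℝ} (hC : MeasurableSet C)
    {M η : ℝ} (hM : ∀ z ∈ C, M ≤ tiltedRate β κ c k z) (hη : 0 < η) :
    ∀ᶠ n in atTop, conditionedLaw β h m a α n C ≤
      ENNReal.ofReal (Real.exp (speed k α n * -(M - η))) := by
  filter_upwards [hc.eventually_massOn_weight_le hβ hα hexp hb hgrowth hM (half_pos hη),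
    hc.eventually_le_massOn_window hβ hκ hα hexp ha (half_pos hη),
    hc.eventually_massOn_window_pos hβ hκ hα hexp ha] with n hC_le hwindow hpos
  rw [conditionedLaw_apply β h m α hC hpos]
  refine ENNReal.ofReal_le_ofReal ((div_le_iff₀ hpos).mpr ?_)
  calc massOn (weight β h) (window m a n ∩ scaledMagnetization m α ⁻¹' C)
      ≤ baseWeight β h m n * Real.exp (-(speed k α n * (M - η / 2))) := hC_le
    _ = Real.exp (speed k α n * -(M - η)) *
          (baseWeight β h m n * Real.exp (-(speed k α n * (η / 2)))) := by
        rw [mul_left_comm, ← Real.exp_add]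
        ring_nf
    _ ≤ Real.exp (speed k α n * -(M - η)) * massOn (weight β h) (window m a n) := by gcongr

theorem IsOptimalTilt.eventually_le_conditionedLaw_ball (hc : IsOptimalTilt β κ c k)
    (hβ : 0 < β) (hκ : 0 ≤ κ) (hα : IsModerateExponent k α)
    (hexp : HasScaledExpansion (empiricalG β h) m α κ k) (ha : 0 < a) (hb : 0 < b)
    (hgrowth : HasScaledGrowth (empiricalG β h) m α a b k)
    (hnonneg : ∀ z, 0 ≤ tiltedRate β κ c k z) (z : ℝ) {δ η : ℝ} (hδ : 0 < δ) (hη : 0 < η) :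
    ∀ᶠ n in atTop, ENNReal.ofReal (Real.exp (speed k α n * -(tiltedRate β κ c k z + η))) ≤
      conditionedLaw β h m a α n (Metric.ball z δ) := by
  filter_upwards [hc.eventually_le_massOn_weight hβ hκ hα hexp ha z hδ (half_pos hη),
    hc.eventually_massOn_weight_le hβ hα hexp hb hgrowth (C := Set.univ) (fun z _ => hnonneg z)
      (half_pos hη), hc.eventually_massOn_window_pos hβ hκ hα hexp ha] with n hball hwindow hpos
  rw [Set.preimage_univ, Set.inter_univ] at hwindow
  rw [conditionedLaw_apply β h m α Metric.isOpen_ball.measurableSet hpos]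
  refine ENNReal.ofReal_le_ofReal ((le_div_iff₀ hpos).mpr ?_)
  calc Real.exp (speed k α n * -(tiltedRate β κ c k z + η)) * massOn (weight β h) (window m a n)
      ≤ Real.exp (speed k α n * -(tiltedRate β κ c k z + η)) *
          (baseWeight β h m n * Real.exp (-(speed k α n * (0 - η / 2)))) := by gcongr
    _ = baseWeight β h m n * Real.exp (-(speed k α n * (tiltedRate β κ c k z + η / 2))) := by
        rw [mul_left_comm, ← Real.exp_add]
        ring_nf
    _ ≤ massOn (weight β h) (window m a n ∩ scaledMagnetization m α ⁻¹' Metric.ball z δ) := hball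

theorem IsOptimalTilt.satisfiesLDP_conditionedLaw (hc : IsOptimalTilt β κ c k) (hβ : 0 < β)
    (hκ : 0 ≤ κ) (hα : IsModerateExponent k α)
    (hexp : HasScaledExpansion (empiricalG β h) m α κ k) (ha : 0 < a) (hb : 0 < b)
    (hgrowth : HasScaledGrowth (empiricalG β h) m α a b k) {w : ℝ} (hw : 0 < w)
    (hrate : ∀ z, tiltedRate β κ c k z = w * z ^ (2 * k)) :
    SatisfiesLDP (conditionedLaw β h m a α) (speed k α)
      fun z => ((w * z ^ (2 * k) : ℝ) : EReal) := by
  have hspeed : ∀ᶠ n in atTop, 0 < speed k α n :=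
    (eventually_ne_atTop 0).mono fun _ hn => speed_pos k α hn
  have hnonneg (z : ℝ) : 0 ≤ tiltedRate β κ c k z :=
    hrate z ▸ mul_nonneg hw.le ((even_two_mul k).pow_nonneg z)
  have hk : k ≠ 0 := by have := hα.one_le; omega
  have hcont : Continuous fun z => ((w * z ^ (2 * k) : ℝ) : EReal) :=
    continuous_coe_real_ereal.comp (by fun_prop)
  refine ⟨hcont.lowerSemicontinuous, fun r => ?_, fun C _ => ?_, fun C hC => ?_⟩
  · simpa only [EReal.coe_le_coe_iff] using isCompact_setOf_mul_pow_le hw hk r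
  · simp only [← hrate]
    exact neg_iInf_interior_le_liminf hspeed (fun z _ _ hδ hη =>
      hc.eventually_le_conditionedLaw_ball hβ hκ hα hexp ha hb hgrowth hnonneg z hδ hη) C
  · simp only [← hrate]
    exact limsup_le_neg_iInf_closure hspeed fun _ _ hM hη =>
      hc.eventually_conditionedLaw_le hβ hκ hα hexp ha hb hgrowth hC hM hη

end ConditionedLaw

section RateFunction

variable {β lam : ℝ} {k : ℕ}

theorem exists_rateFunction_eq_mul_pow (hlam : 0 < lam) (hlt : k = 1 → lam < β) :
    ∃ w > 0, ∀ x, rateFunction k lam β x = w * x ^ (2 * k) := by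
  by_cases hk : k = 1
  · have hσ : 0 < lam⁻¹ - β⁻¹ := sub_pos.mpr (inv_strictAnti₀ hlam (hlt hk))
    refine ⟨(2 * (lam⁻¹ - β⁻¹))⁻¹, by positivity, fun x => ?_⟩
    rw [rateFunction, if_pos hk, hk, mul_one, div_eq_inv_mul]
  · refine ⟨lam / (2 * k).factorial, by positivity, fun x => ?_⟩
    rw [rateFunction, if_neg hk, div_mul_eq_mul_div]

theorem exists_isOptimalTilt (hlam : 0 < lam) (hlt : k = 1 → lam < β) :
    ∃ c, IsOptimalTilt β (lam / (2 * k).factorial) c k ∧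
      ∀ z, tiltedRate β (lam / (2 * k).factorial) c k z = rateFunction k lam β z := by
  by_cases hk : k = 1
  · subst hk
    have hsub : 0 < β - lam := sub_pos.mpr (hlt rfl)
    have hβ : 0 < β := hlam.trans (hlt rfl)
    have hσ : lam⁻¹ - β⁻¹ = (β - lam) / (lam * β) := by field_simp
    refine ⟨β / (β - lam), ?_, fun z => ?_⟩
    · simp only [IsOptimalTilt, if_true, mul_one, Nat.factorial_two, Nat.cast_ofNat]
      field_simp
      ring
    · simp only [tiltedRate, rateFunction, if_true, mul_one, Nat.factorial_two, Nat.cast_ofNat, hσ]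
      field_simp
      ring
  · refine ⟨1, by simp [IsOptimalTilt, hk], fun z => ?_⟩
    rw [tiltedRate, rateFunction, if_neg hk]
    ring

end RateFunction

end

end RFCW

theorem mainTheorem1_general (ν : Measure ℝ) [IsProbabilityMeasure ν] (β : ℝ) (hβ : 0 < β)
    (hν : Integrable (fun y : ℝ => y) ν)
    (m : ℝ) (k : ℕ) (lam : ℝ) (hm : RFCW.IsMinimumOfType (RFCW.G β ν) m k lam) :
    ∃ A : ℝ, 0 < A ∧ ∀ᵐ h ∂(RFCW.fieldLaw ν), ∀ a : ℝ, 0 < a → a < A →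
      ∀ α : ℝ, 1 - 1 / (2 * (2 * (k : ℝ) - 1)) < α → α < 1 →
        RFCW.SatisfiesLDP (RFCW.conditionedLaw β h m a α)
          (fun n => (n : ℝ) ^ (1 - 2 * (k : ℝ) * (1 - α)))
          (fun x => ((RFCW.rateFunction k lam β x : ℝ) : EReal)) := by
  have hlam := hm.strength_pos
  have hκ : 0 < lam / (2 * k).factorial := by positivity
  have hlt : k = 1 → lam < β := by
    rintro rfl
    exact hm.strength_lt hβ.ne' hν
  obtain ⟨A, hA, hA1, hlower⟩ := hm.exists_forall_le
  obtain ⟨w, hw, hrate⟩ := RFCW.exists_rateFunction_eq_mul_pow hlam hlt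
  obtain ⟨c, hc, htilted⟩ := RFCW.exists_isOptimalTilt hlam hlt
  refine ⟨A, hA, ?_⟩
  filter_upwards [RFCW.ae_isTypicalField hβ hν m] with h hh a ha haA α hα hα1
  have hmoderate : RFCW.IsModerateExponent k α := ⟨hm.one_le, hα, hα1⟩
  have hexp := hh.hasScaledExpansion hmoderate
    (RFCW.hasScaledExpansion_of_isLittleO hm.isLittleO hmoderate)
  have hgrowth := hh.hasScaledGrowth hmoderate (half_pos hκ) (haA.le.trans hA1)
    fun u hu => hlower u (hu.trans haA.le)
  simp only [hrate] at htilted ⊢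
  exact hc.satisfiesLDP_conditionedLaw hβ hκ.le hmoderate hexp ha (by positivity) hgrowth hw
    htilted

theorem mainTheorem1 (ν : Measure ℝ) [IsProbabilityMeasure ν] (β : ℝ) (hβ : 0 < β)
    (hν : Integrable (fun y : ℝ => y ^ 2) ν)
    (m : ℝ) (k : ℕ) (lam : ℝ) (hm : RFCW.IsMinimumOfType (RFCW.G β ν) m k lam)
    (hcond : ENNReal.ofReal (2 * RFCW.height (RFCW.G β ν) m) / RFCW.broadness (RFCW.G β ν) m ^ 2
      < ENNReal.ofReal β) :
    ∃ A : ℝ, 0 < A ∧ ∀ᵐ h ∂(RFCW.fieldLaw ν), ∀ a : ℝ, 0 < a → a < A →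
      ∀ α : ℝ, 1 - 1 / (2 * (2 * (k : ℝ) - 1)) < α → α < 1 →
        RFCW.SatisfiesLDP (RFCW.conditionedLaw β h m a α)
          (fun n => (n : ℝ) ^ (1 - 2 * (k : ℝ) * (1 - α)))
          (fun x => ((RFCW.rateFunction k lam β x : ℝ) : EReal)) := by
  exact mainTheorem1_general ν β hβ
    (((memLp_two_iff_integrable_sq measurable_id.aestronglyMeasurable).mpr hν).integrable
      one_le_two) m k lam hm
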